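/- Let $d\ge 2$, let $\Omega\subset\mathbb R^d$ be a polytopal domain (a connected set that is the interior of a finite union of closed simplices), let $\varrho>0$ and let $k,l\ge 0$ be integers with $|k-l|\le 1$. Then there is a constant $C>0$, depending only on $\Omega,d,\varrho,k,l$, such that the following holds for every polytopal mesh $(\mathcal T,\mathcal F)$ of $\Omega$ all of whose elements and faces are connected by star-shaped sets with parameter $\varrho$, every element $T\in\mathcal T$, every symmetric matrix $K\in\mathbb R^{d\times d}$ and all reals $0<\underline K\le\overline K$ with $\underline K\,x\cdot x\le Kx\cdot x\le\overline K\,x\cdot x$ for all $x\in\mathbb R^d$. Put $\alpha=\overline K/\underline K$. Here a polytopal mesh consists of a finite set $\mathcal T$ of pairwise disjoint polytopes (sets of the kind required of $\Omega$) with $\overline\Omega=\bigcup_{T\in\mathcal T}\overline T$, and a finite set $\mathcal F$ of pairwise disjoint non-empty connected relatively open subsets of hyperplanes, with relative boundaries of zero $(d-1)$-dimensional measure, such that $\bigcup_{T}\partial T=\bigcup_{F}\overline F$ and each $F\in\mathcal F$ is contained either in $\partial T_1\cap\partial T_2$ for two distinct elements or in $\partial T\cap\partial\Omega$ for an element $T$;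 writing $\mathcal F_T=\{F\in\mathcal F: F\subset\partial T\}$, each $T$ lies on one side of each $F\in\mathcal F_T$, i.e. there is a constant unit normal $n_{TF}$ to $F$ pointing out of $T$ at almost every point of $F$. A set $X$ of diameter $h_X$ is connected by star-shaped sets with parameter $\varrho$ if it is a union of $N\le\varrho^{-1}$ sets $X_i$, each star-shaped with respect to all points of a ball of radius $\varrho h_{X_i}$, any two of which are joined by a chain of these sets whose consecutive intersections contain a ball of radius $\varrho h_X$ (balls are taken in the affine hull of $X$). Let $\mathbb P^m(X)$ be the polynomials of degree at most $m$ on $X$, $\pi_X^{0,m}$ the $L^2(X)$-orthogonal projector onto $\mathbb P^m(X)$, and $\underline U_T^{k,l}=\mathbb P^l(T)\times\mathbb P^k(\mathcal F_T)$, where $\mathbb P^k(\mathcal F_T)$ is the space of functions on $\bigcup_{F\in\mathcal F_T}F$ whose restriction to each $F\in\mathcal F_T$ lies in $\mathbb P^k(F)$, and $\pi_{\partial T}^{0,k}$ acts on each face as $\pi_F^{0,k}$. Write $(f,g)_T=\int_T fg$ (with the dot product for vector-valued functions), $(f,g)_{\partial T}=\sum_{F\in\mathcal F_T}\int_F fg$,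 $(f,g)_{K,\partial T}=\sum_{F\in\mathcal F_T}\int_F (Kn_{TF}\cdot n_{TF})\,fg$, $\|f\|_{K,\partial T}^2=(f,f)_{K,\partial T}$, and let $n_{\partial T}=n_{TF}$ on $F$. For $\underline v=(v_T,v_{\partial T})\in\underline U_T^{k,l}$ let $p\,\underline v\in\mathbb P^{k+1}(T)$ be the solution of $$(K\nabla p\,\underline v,\nabla w)_T=-(v_T,\nabla\cdot(K\nabla w))_T+(v_{\partial T},K\nabla w\cdot n_{\partial T})_{\partial T}\quad\forall w\in\mathbb P^{k+1}(T),\qquad (v_T-p\,\underline v,1)_T=0,$$ and let $\delta_T\underline v=\pi_T^{0,l}(p\,\underline v-v_T)$, $\delta_{\partial T}\underline v=\pi_{\partial T}^{0,k}(p\,\underline v-v_{\partial T})$. Define $$s_T^{\nabla,\min}(\underline u,\underline v)=\underline K\big[(\nabla\delta_T\underline u,\nabla\delta_T\underline v)_T+h_T^{-1}(\delta_{\partial T}\underline u,\delta_{\partial T}\underline v)_{\partial T}\big],$$ $$s_T^{\nabla,\max}(\underline u,\underline v)=\overline K\big[(\nabla\delta_T\underline u,\nabla\delta_T\underline v)_T+h_T^{-1}(\delta_{\partial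 T}\underline u,\delta_{\partial T}\underline v)_{\partial T}\big],$$ $$s_T^{\partial}(\underline u,\underline v)=h_T^{-1}(\delta_{\partial T}\underline u-\delta_T\underline u,\delta_{\partial T}\underline v-\delta_T\underline v)_{K,\partial T}.$$ Then each $s_T\in\{s_T^{\nabla,\min},\,s_T^{\partial},\,s_T^{\nabla,\max}\}$ is coercive in the following sense: with $a_T(\underline u,\underline v)=(K\nabla p\,\underline u,\nabla p\,\underline v)_T+s_T(\underline u,\underline v)$ and $|\underline v|_{1,K,\partial T}=h_T^{-1/2}\|v_{\partial T}-v_T\|_{K,\partial T}$, $$|\underline v|_{1,K,\partial T}^2\le C\,\alpha\,a_T(\underline v,\underline v)\qquad\text{for all }\underline v\in\underline U_T^{k,l}.$$ -/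

import Mathlib

open MeasureTheory Set Filter Topology
open scoped Matrix

noncomputable section

namespace HHO

/-- Euclidean space `ℝ^d`. -/
abbrev E (d : ℕ) : Type := EuclideanSpace ℝ (Fin d)

/-! ### Polytopes and polytopal meshes -/

/-- A polytope: a connected (in particular non-empty) set that is the interior of a finite union of
closed non-degenerate simplices.  Such a set is open, bounded and has no cracks. -/
def IsPolytope {d : ℕ} (T : Set (E d)) : Prop :=
  IsConnected T ∧ ∃ S : Finset (Fin (d + 1) → E d),
    (∀ s ∈ S, AffineIndependent ℝ s) ∧
      T = interior (⋃ s ∈ S, convexHull ℝ (Set.range s))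

/-- The `(d-1)`-dimensional surface measure of `ℝ^d`, normalised so that it agrees with the
`(d-1)`-dimensional Lebesgue measure on hyperplanes. -/
def surf (d : ℕ) : Measure (E d) := Measure.euclideanHausdorffMeasure (d - 1)

/-- `F` is a non-empty, connected, relatively open subset of a hyperplane, whose relative boundary
has zero surface measure. -/
def IsFlatFace {d : ℕ} (F : Set (E d)) : Prop :=
  IsConnected F ∧
  (∃ (ν : E d) (c : ℝ) (U : Set (E d)), ν ≠ 0 ∧ IsOpen U ∧ F = U ∩ {x | inner ℝ ν x = c}) ∧
  surf d (closure F \ F) = 0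

/-- `n` is the unit normal to `F` pointing out of `T`: `n` has norm one, is orthogonal to `F` and,
at almost every point of `F`, the set `T` is locally on the side of `-n`. -/
def IsOutwardUnitNormal {d : ℕ} (T F : Set (E d)) (n : E d) : Prop :=
  ‖n‖ = 1 ∧ (∀ x ∈ F, ∀ y ∈ F, inner ℝ n (x - y) = 0) ∧
  ∀ᵐ x ∂((surf d).restrict F), ∀ᶠ ε : ℝ in 𝓝[>] 0, x - ε • n ∈ T ∧ x + ε • n ∉ T

/-- The (constant) unit normal `n_{TF}` to the face `F` of `T` pointing out of `T`. -/
def outwardNormal {d : ℕ} (T F : Set (E d)) : E d :=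
  Classical.epsilon (IsOutwardUnitNormal T F)

/-- A polytopal mesh `(𝒯, ℱ)` of `Ω ⊆ ℝ^d`. -/
structure PolytopalMesh {d : ℕ} (Ω : Set (E d)) where
  /-- the mesh elements -/
  elements : Finset (Set (E d))
  /-- the mesh faces -/
  faces : Finset (Set (E d))
  polytope : ∀ T ∈ elements, IsPolytope T
  elements_disjoint : (elements : Set (Set (E d))).PairwiseDisjoint id
  closure_eq : closure Ω = ⋃ T ∈ elements, closure T
  flat : ∀ F ∈ faces, IsFlatFace F
  faces_disjoint : (faces : Set (Set (E d))).PairwiseDisjoint id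
  /-- each face is an interface between two elements or a boundary face -/
  interface_or_boundary : ∀ F ∈ faces,
    (∃ T₁ ∈ elements, ∃ T₂ ∈ elements, T₁ ≠ T₂ ∧ F ⊆ frontier T₁ ∩ frontier T₂) ∨
    (∃ T ∈ elements, F ⊆ frontier T ∩ frontier Ω)
  skeleton : (⋃ T ∈ elements, frontier T) = ⋃ F ∈ faces, closure F
  /-- an element lies on one side of each of its faces, so that `n_{TF}` makes sense -/
  one_sided : ∀ T ∈ elements, ∀ F ∈ faces, F ⊆ frontier T → ∃ n, IsOutwardUnitNormal T F n

open Classical in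
/-- The faces `ℱ_T` of the element `T`. -/
def PolytopalMesh.facesOf {d : ℕ} {Ω : Set (E d)} (M : PolytopalMesh Ω) (T : Set (E d)) :
    Finset (Set (E d)) :=
  M.faces.filter fun F => F ⊆ frontier T

/-- The ball of centre `c` and radius `r` within the affine hull of `X` (for an element this is a
ball of `ℝ^d`, for a face a ball of its hyperplane). -/
def relBall {d : ℕ} (X : Set (E d)) (c : E d) (r : ℝ) : Set (E d) :=
  Metric.ball c r ∩ (affineSpan ℝ X : Set (E d))

/-- `X` is connected by star-shaped sets with parameter `ϱ`: it is the union of `N ≤ 1/ϱ` sets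
`X_i`, each star-shaped with respect to all points of a ball of radius `ϱ h_{X_i}`, and any two of
them are joined by a chain of these sets in which consecutive sets have an intersection containing
a ball of radius `ϱ h_X`. -/
def IsConnectedByStarShaped {d : ℕ} (ϱ : ℝ) (X : Set (E d)) : Prop :=
  ∃ (N : ℕ) (Y : Fin N → Set (E d)), (N : ℝ) ≤ ϱ⁻¹ ∧ X = ⋃ i, Y i ∧
    (∀ i, ∃ c ∈ affineSpan ℝ X, ∀ y ∈ relBall X c (ϱ * Metric.diam (Y i)), StarConvex ℝ y (Y i)) ∧
    ∀ i j, Relation.ReflTransGen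
      (fun a b => ∃ c ∈ affineSpan ℝ X, relBall X c (ϱ * Metric.diam X) ⊆ Y a ∩ Y b) i j

/-- The mesh regularity assumption with parameter `ϱ`. -/
def PolytopalMesh.IsRegular {d : ℕ} {Ω : Set (E d)} (M : PolytopalMesh Ω) (ϱ : ℝ) : Prop :=
  (∀ T ∈ M.elements, IsConnectedByStarShaped ϱ T) ∧
    ∀ F ∈ M.faces, IsConnectedByStarShaped ϱ F

/-! ### Polynomials -/

/-- Polynomials of total degree at most `m` in `d` variables.  On an element (a non-empty open set)
they are identified with the polynomial functions of degree at most `m`. -/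
abbrev Poly (d m : ℕ) : Submodule ℝ (MvPolynomial (Fin d) ℝ) :=
  MvPolynomial.restrictTotalDegree (Fin d) ℝ m

/-- The polynomial function on `ℝ^d`. -/
def ev {d : ℕ} (p : MvPolynomial (Fin d) ℝ) (x : E d) : ℝ := MvPolynomial.eval (fun i => x i) p

/-- The gradient `∇p` at `x`. -/
def grad {d : ℕ} (p : MvPolynomial (Fin d) ℝ) (x : E d) : Fin d → ℝ :=
  fun i => ev (MvPolynomial.pderiv i p) x

/-- `∇ · (K ∇p)` at `x`, for a constant matrix `K`. -/
def divGrad {d : ℕ} (K : Matrix (Fin d) (Fin d) ℝ) (p : MvPolynomial (Fin d) ℝ) (x : E d) : ℝ :=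
  ∑ i, ∑ j, K i j * ev (MvPolynomial.pderiv i (MvPolynomial.pderiv j p)) x

/-- `ℙ^k(ℱ)`: functions whose restriction to each face `F ∈ ℱ` is a polynomial of degree at most
`k` on `F`, i.e. the restriction to `F` of such a polynomial on `ℝ^d`.  The values away from the
faces are irrelevant: everything below depends only on the restrictions to the faces. -/
def FacePoly {d : ℕ} (k : ℕ) (𝓕 : Finset (Set (E d))) : Submodule ℝ (E d → ℝ) where
  carrier := {g | ∀ F ∈ 𝓕, ∃ p ∈ Poly d k, Set.EqOn g (ev p) F}
  add_mem' := by
    intro a b ha hb F hF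
    obtain ⟨p, hp, hpa⟩ := ha F hF
    obtain ⟨q, hq, hqb⟩ := hb F hF
    exact ⟨p + q, add_mem hp hq, fun x hx => by simp [ev, hpa hx, hqb hx]⟩
  zero_mem' := fun F _ => ⟨0, zero_mem _, fun x _ => by simp [ev]⟩
  smul_mem' := by
    intro c a ha F hF
    obtain ⟨p, hp, hpa⟩ := ha F hF
    exact ⟨c • p, Submodule.smul_mem _ c hp, fun x hx => by simp [ev, hpa hx]⟩

/-- The `L²(μ)`-orthogonal projection of `g` on the polynomials of degree at most `m`.  Here `μ` is
the Lebesgue measure on an element, or the surface measure on a face; in the latter case the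
projection is a function on the face, given by some polynomial on `ℝ^d` that restricts to it (only
the restriction to the face is ever used, and it is unique). -/
def l2Proj {d : ℕ} (μ : Measure (E d)) (m : ℕ) (g : E d → ℝ) : MvPolynomial (Fin d) ℝ :=
  Classical.epsilon fun q =>
    q ∈ Poly d m ∧ ∀ w ∈ Poly d m, ∫ x, ev q x * ev w x ∂μ = ∫ x, g x * ev w x ∂μ

/-! ### The local Hybrid High-Order space and its operators

In what follows `T` is an element, `𝓕` the set of its faces and `K` the constant value of the
diffusion tensor on `T`. -/

/-- The local space of unknowns `ℙ^l(T) × ℙ^k(ℱ_T)`. -/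
abbrev LocalSpace {d : ℕ} (𝓕 : Finset (Set (E d))) (k l : ℕ) : Type :=
  Poly d l × FacePoly k 𝓕

section Operators

variable {d : ℕ} (T : Set (E d)) (𝓕 : Finset (Set (E d))) (K : Matrix (Fin d) (Fin d) ℝ)
  (Klo Khi : ℝ) {k l : ℕ}

/-- The coefficient `K n_{TF} · n_{TF}`. -/
def normalCoeff (F : Set (E d)) : ℝ :=
  (K *ᵥ (outwardNormal T F).ofLp) ⬝ᵥ (outwardNormal T F).ofLp

/-- `p` satisfies the equations of the potential reconstruction of `v`:
`(K∇p, ∇w)_T = -(v_T, ∇·(K∇w))_T + (v_{∂T}, K∇w · n_{∂T})_{∂T}` for all `w ∈ ℙ^{k+1}(T)` and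
`(v_T - p, 1)_T = 0`. -/
def IsPotential (v : LocalSpace 𝓕 k l) (p : MvPolynomial (Fin d) ℝ) : Prop :=
  p ∈ Poly d (k + 1) ∧
  (∀ w ∈ Poly d (k + 1),
    ∫ x in T, (K *ᵥ grad p x) ⬝ᵥ grad w x =
      -(∫ x in T, ev v.1.1 x * divGrad K w x) +
        ∑ F ∈ 𝓕, ∫ x in F, v.2.1 x * ((K *ᵥ grad w x) ⬝ᵥ (outwardNormal T F).ofLp) ∂(surf d)) ∧
  ∫ x in T, (ev v.1.1 x - ev p x) = 0

/-- The potential reconstruction `p_{K,T}^{k+1} v`: the (unique) solution of these equations. -/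
def potential (v : LocalSpace 𝓕 k l) : MvPolynomial (Fin d) ℝ :=
  Classical.epsilon (IsPotential T 𝓕 K v)

/-- The difference operator `δ_{K,T}^l v = π_T^{0,l} (p_{K,T}^{k+1} v - v_T)`. -/
def deltaElem (v : LocalSpace 𝓕 k l) : MvPolynomial (Fin d) ℝ :=
  l2Proj (volume.restrict T) l fun x => ev (potential T 𝓕 K v) x - ev v.1.1 x

/-- The difference operator `δ_{K,∂T}^k v`, restricted to the face `F`:
`π_F^{0,k} (p_{K,T}^{k+1} v - v_{∂T})`. -/
def deltaFace (v : LocalSpace 𝓕 k l) (F : Set (E d)) : MvPolynomial (Fin d) ℝ :=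
  l2Proj ((surf d).restrict F) k fun x => ev (potential T 𝓕 K v) x - v.2.1 x

/-- The seminorm `|v|_{1,K,∂T} = h_T^{-1/2} ‖v_{∂T} - v_T‖_{K,∂T}`. -/
def bdrySeminorm (v : LocalSpace 𝓕 k l) : ℝ :=
  Metric.diam T ^ (-(1 / 2) : ℝ) *
    Real.sqrt (∑ F ∈ 𝓕, ∫ x in F, normalCoeff T K F * (v.2.1 x - ev v.1.1 x) ^ 2 ∂(surf d))

/-- The unscaled gradient-based form
`(∇δ_T u, ∇δ_T v)_T + h_T^{-1} (δ_{∂T} u, δ_{∂T} v)_{∂T}`. -/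
def gradForm (u v : LocalSpace 𝓕 k l) : ℝ :=
  (∫ x in T, grad (deltaElem T 𝓕 K u) x ⬝ᵥ grad (deltaElem T 𝓕 K v) x) +
    (Metric.diam T)⁻¹ * ∑ F ∈ 𝓕,
      ∫ x in F, ev (deltaFace T 𝓕 K u F) x * ev (deltaFace T 𝓕 K v F) x ∂(surf d)

/-- The minimally scaled gradient-based stabilisation. -/
def stabGradMin (u v : LocalSpace 𝓕 k l) : ℝ := Klo * gradForm T 𝓕 K u v

/-- The maximally scaled gradient-based stabilisation. -/
def stabGradMax (u v : LocalSpace 𝓕 k l) : ℝ := Khi * gradForm T 𝓕 K u v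

/-- The boundary stabilisation
`h_T^{-1} (δ_{∂T} u - δ_T u, δ_{∂T} v - δ_T v)_{K,∂T}`. -/
def stabBdry (u v : LocalSpace 𝓕 k l) : ℝ :=
  (Metric.diam T)⁻¹ * ∑ F ∈ 𝓕, ∫ x in F, normalCoeff T K F *
    ((ev (deltaFace T 𝓕 K u F) x - ev (deltaElem T 𝓕 K u) x) *
      (ev (deltaFace T 𝓕 K v F) x - ev (deltaElem T 𝓕 K v) x)) ∂(surf d)

/-- The local bilinear form `a_T(u,v) = (K∇p u, ∇p v)_T + s_T(u,v)` with stabilisation `s`. -/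
def localForm (s : LocalSpace 𝓕 k l → LocalSpace 𝓕 k l → ℝ) (u v : LocalSpace 𝓕 k l) : ℝ :=
  (∫ x in T, (K *ᵥ grad (potential T 𝓕 K u) x) ⬝ᵥ grad (potential T 𝓕 K v) x) + s u v

/-- The coercivity condition `|v|_{1,K,∂T}² ≤ C α_T a_T(v,v)` for all `v`, with the anisotropy
ratio `α_T = Khi / Klo`. -/
def IsCoerciveStab (C : ℝ) (s : LocalSpace 𝓕 k l → LocalSpace 𝓕 k l → ℝ) : Prop :=
  ∀ v : LocalSpace 𝓕 k l,
    bdrySeminorm T 𝓕 K v ^ 2 ≤ C * (Khi / Klo) * localForm T 𝓕 K s v v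

end Operators

end HHO

end

/-!
Coercivity of three stabilisations of the Hybrid High-Order method, uniformly in the mesh and with
a linear dependence on the anisotropy ratio.

Let `p` be the potential of `v`, `c` its mean value on the element `T`, and `δ_T`, `δ_F` the
difference operators. Then `v_T + δ_T - c` and `v_F + δ_F - c` are the `L²`-projections of `p - c`
on `T` and on the face `F`, and on `F`

  `v_F - v_T = (v_F + δ_F - c) - (v_T + δ_T - c) - (δ_F - δ_T)`.

The `L²`-contractivity of projections, a discrete trace inequality (`exists_trace_const`) and a
Poincaré inequality on polynomials (`exists_poincare_const`) bound the first two terms by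
`h_T^{1/2} ‖∇p‖_T`, which costs the factor `α` when it is compared with the energy of `p`; the last
term is the boundary stabilisation (`bdrySeminorm_sq_le`). The boundary stabilisation is in turn
controlled by the gradient-based ones, because `δ_T` has zero mean value (`stabBdry_self_le`).

Both polynomial inequalities rest on the equivalence of norms on a finite-dimensional space:
`T` lies in a ball of radius `h_T` and contains a ball of comparable radius, so that the supremum of
a polynomial over the large ball is controlled by its mean square over the small one
(`exists_sup_sq_le_integral_ball`). The faces of `T` may be numerous and small, and the trace
inequality only uses that the boundary of `T` has area at most `C h_T^{d-1}`
(`exists_surf_frontier_le`). This holds since the boundary of `T` is covered by the boundaries of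
boundedly many sets that are star-shaped with respect to a ball of radius comparable to `h_T`, and
the inverse of the central projection of such a boundary to the boundary of a cube is Lipschitz
(`dist_le_of_mem_sector`).

The operators are defined by choice, so that the projections and the potential must also be shown to
exist (`l2Proj_spec`, `exists_isPotential`); both follow from the fact that a symmetric form
represents each functional that vanishes on its kernel. Uniqueness is not needed.
-/

noncomputable section

namespace HHO

variable {d : ℕ}

/-! ### Polynomial functions -/

@[simp] lemma ev_add (p q : MvPolynomial (Fin d) ℝ) (x : E d) :
    ev (p + q) x = ev p x + ev q x := by simp [ev]

@[simp] lemma ev_sub (p q : MvPolynomial (Fin d) ℝ) (x : E d) :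
    ev (p - q) x = ev p x - ev q x := by simp [ev]

@[simp] lemma ev_mul (p q : MvPolynomial (Fin d) ℝ) (x : E d) :
    ev (p * q) x = ev p x * ev q x := by simp [ev]

@[simp] lemma ev_smul (c : ℝ) (p : MvPolynomial (Fin d) ℝ) (x : E d) :
    ev (c • p) x = c * ev p x := by simp [ev]

@[simp] lemma ev_C (c : ℝ) (x : E d) : ev (MvPolynomial.C c) x = c := by simp [ev]

@[simp] lemma ev_zero (x : E d) : ev 0 x = 0 := by simp [ev]

@[simp] lemma ev_pow (p : MvPolynomial (Fin d) ℝ) (n : ℕ) (x : E d) :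
    ev (p ^ n) x = ev p x ^ n := by simp [ev]

@[simp] lemma ev_sum {ι : Type*} (s : Finset ι) (f : ι → MvPolynomial (Fin d) ℝ) (x : E d) :
    ev (∑ i ∈ s, f i) x = ∑ i ∈ s, ev (f i) x := by simp [ev]

@[fun_prop]
lemma continuous_ev (p : MvPolynomial (Fin d) ℝ) : Continuous (ev p) := by
  unfold ev
  exact (MvPolynomial.continuous_eval p).comp (by fun_prop)

lemma C_mem_Poly (c : ℝ) (m : ℕ) : MvPolynomial.C c ∈ Poly d m := by
  rw [MvPolynomial.mem_restrictTotalDegree]; simp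

lemma Poly_mono {m n : ℕ} (h : m ≤ n) : Poly d m ≤ Poly d n := fun p hp => by
  rw [MvPolynomial.mem_restrictTotalDegree] at *; exact hp.trans h

lemma pderiv_mem_Poly {m : ℕ} {p : MvPolynomial (Fin d) ℝ} (hp : p ∈ Poly d m) (i : Fin d) :
    MvPolynomial.pderiv i p ∈ Poly d m := by
  rw [MvPolynomial.mem_restrictTotalDegree] at *
  rw [p.as_sum, map_sum]
  refine MvPolynomial.totalDegree_finsetSum_le fun s hs => ?_
  rw [MvPolynomial.pderiv_monomial]
  refine (MvPolynomial.totalDegree_monomial_le _ _).trans ?_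
  refine le_trans ?_ ((MvPolynomial.le_totalDegree hs).trans hp)
  rw [Finsupp.sum_fintype _ _ (fun _ => rfl), Finsupp.sum_fintype _ _ (fun _ => rfl)]
  exact Finset.sum_le_sum fun j _ => by simp

/-- The polynomial `y ↦ p (a + h y)`. -/
def rescale (a : E d) (h : ℝ) (p : MvPolynomial (Fin d) ℝ) : MvPolynomial (Fin d) ℝ :=
  MvPolynomial.aeval (fun i => MvPolynomial.C (a i) + MvPolynomial.C h * MvPolynomial.X i) p

lemma ev_rescale (a : E d) (h : ℝ) (p : MvPolynomial (Fin d) ℝ) (y : E d) :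
    ev (rescale a h p) y = ev p (a + h • y) := by
  unfold ev rescale
  induction p using MvPolynomial.induction_on with
  | C c => simp
  | add p q hp hq => simp only [map_add, hp, hq]
  | mul_X p i hp => rw [map_mul, map_mul, hp, map_mul]; simp

lemma rescale_mem_Poly (a : E d) (h : ℝ) {m : ℕ} {p : MvPolynomial (Fin d) ℝ}
    (hp : p ∈ Poly d m) : rescale a h p ∈ Poly d m := by
  rw [MvPolynomial.mem_restrictTotalDegree] at *
  unfold rescale
  rw [MvPolynomial.aeval_def, MvPolynomial.eval₂_eq]
  refine MvPolynomial.totalDegree_finsetSum_le fun s hs => ?_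
  refine (MvPolynomial.totalDegree_mul _ _).trans ?_
  refine le_trans (add_le_add le_rfl (MvPolynomial.totalDegree_finsetProd _ _)) ?_
  refine le_trans ?_ ((MvPolynomial.le_totalDegree hs).trans hp)
  simp only [MvPolynomial.algebraMap_eq, MvPolynomial.totalDegree_C, zero_add, Finsupp.sum]
  refine Finset.sum_le_sum fun i _ => (MvPolynomial.totalDegree_pow _ _).trans ?_
  refine mul_le_of_le_one_right' ?_
  refine (MvPolynomial.totalDegree_add _ _).trans ?_
  simp only [MvPolynomial.totalDegree_C, zero_le, sup_of_le_right]
  refine (MvPolynomial.totalDegree_mul _ _).trans ?_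
  simp

/-- A polynomial that vanishes on a non-empty open set is zero. -/
lemma eq_zero_of_eqOn_open {U : Set (E d)} (hU : IsOpen U) (hne : U.Nonempty)
    {p : MvPolynomial (Fin d) ℝ} (h : ∀ x ∈ U, ev p x = 0) : p = 0 := by
  obtain ⟨a, ha⟩ := hne
  have hV : IsOpen ((fun x : Fin d → ℝ => WithLp.toLp 2 x) ⁻¹' U) :=
    hU.preimage (by fun_prop)
  obtain ⟨ε, hε, hball⟩ := Metric.isOpen_iff.1 hV a.ofLp (by simpa using ha)
  refine MvPolynomial.funext_set (fun i => Metric.ball (a i) ε) (fun i => ?_) fun x hx => ?_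
  · rw [Real.ball_eq_Ioo]
    exact Set.Ioo_infinite (by linarith)
  · have := h (WithLp.toLp 2 x) (hball ?_)
    · simpa [ev] using this
    · rw [ball_pi _ hε]; exact hx

lemma integrableOn_ev {s : Set (E d)} (hs : MeasurableSet s) (hb : Bornology.IsBounded s)
    {μ : Measure (E d)} (hμ : μ s ≠ ⊤) (p : MvPolynomial (Fin d) ℝ) : IntegrableOn (ev p) s μ := by
  obtain ⟨C, hC⟩ := (hb.isCompact_closure).exists_bound_of_continuousOn
    (continuous_ev p).continuousOn
  refine Measure.integrableOn_of_bounded (M := C) hμ (continuous_ev p).aestronglyMeasurable ?_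
  exact (ae_restrict_iff' hs).2 (Eventually.of_forall fun x hx => hC x (subset_closure hx))

lemma integrableOn_ev_sq {s : Set (E d)} (hs : MeasurableSet s) (hb : Bornology.IsBounded s)
    {μ : Measure (E d)} (hμ : μ s ≠ ⊤) (p : MvPolynomial (Fin d) ℝ) :
    IntegrableOn (fun x => ev p x ^ 2) s μ :=
  (integrableOn_ev hs hb hμ (p ^ 2)).congr_fun (fun x _ => ev_pow p 2 x) hs

lemma eq_zero_of_setIntegral_sq_eq_zero {U : Set (E d)} (hU : IsOpen U) (hne : U.Nonempty)
    (hb : Bornology.IsBounded U) {p : MvPolynomial (Fin d) ℝ}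
    (h : ∫ x in U, ev p x ^ 2 = 0) : p = 0 := by
  refine eq_zero_of_eqOn_open hU hne ?_
  have hi : IntegrableOn (fun x => ev p x ^ 2) U volume :=
    integrableOn_ev_sq hU.measurableSet hb hb.measure_lt_top.ne p
  rw [integral_eq_zero_iff_of_nonneg (fun x => sq_nonneg _) hi] at h
  have := Measure.eqOn_open_of_ae_eq h hU
    ((continuous_ev p).pow 2).continuousOn continuousOn_const
  intro x hx
  simpa using this hx

/-- Norm equivalence in the space of polynomials of degree at most `m`, from the compactness of the
unit sphere of coefficient vectors. -/
lemma exists_sup_sq_le_integral (m : ℕ) {r : ℝ} (hr : 0 < r) :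
    ∃ C : ℝ, 0 < C ∧ ∀ p ∈ Poly d m, ∀ x ∈ Metric.closedBall (0 : E d) 1,
      ev p x ^ 2 ≤ C * ∫ y in Metric.ball (0 : E d) r, ev p y ^ 2 := by
  let b := Module.finBasis ℝ (Poly d m)
  let f : (Fin (Module.finrank ℝ (Poly d m)) → ℝ) → E d → ℝ := fun a x =>
    ∑ i, a i * ev (b i).1 x
  have hf : Continuous (Function.uncurry f) := by
    refine continuous_finsetSum _ fun i _ => ?_
    exact ((continuous_apply i).comp continuous_fst).mul ((continuous_ev _).comp continuous_snd)
  have hfe : ∀ (q : Poly d m) x, f (b.repr q) x = ev q.1 x := by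
    intro q x
    conv_rhs => rw [← b.sum_repr q]
    simp only [f, Submodule.coe_sum, Submodule.coe_smul, ev_sum, ev_smul]
  have hfs : ∀ c a x, f (c • a) x = c * f a x := by
    intro c a x
    simp [f, Finset.mul_sum, mul_assoc]
  let S := Metric.sphere (0 : Fin (Module.finrank ℝ (Poly d m)) → ℝ) 1
  have hS : IsCompact S := isCompact_sphere _ _
  obtain ⟨M, hM⟩ := (hS.prod (isCompact_closedBall (0 : E d) 1)).exists_bound_of_continuousOn
    hf.continuousOn
  -- a compact domain of integration makes the mean square continuous in the coefficients
  have hN : Continuous fun a => ∫ y in Metric.closedBall (0 : E d) (r / 2), f a y ^ 2 :=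
    continuous_parametric_integral_of_continuous (hf.pow 2) (isCompact_closedBall _ _)
  have hint : ∀ a R, IntegrableOn (fun y => f a y ^ 2) (Metric.closedBall (0 : E d) R) := by
    intro a R
    refine ContinuousOn.integrableOn_compact (isCompact_closedBall _ _) (Continuous.continuousOn ?_)
    exact (hf.comp (by fun_prop : Continuous fun y => (a, y))).pow 2
  obtain ⟨c, hc, hcN⟩ := hS.exists_forall_le' (a := 0) hN.continuousOn (by
    intro a ha
    by_contra hcon
    have h0 : ∫ y in Metric.ball (0 : E d) (r / 2), f a y ^ 2 = 0 := by
      refine le_antisymm (le_trans ?_ (not_lt.1 hcon)) (integral_nonneg fun _ => sq_nonneg _)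
      exact setIntegral_mono_set (hint a _) (Eventually.of_forall fun _ => sq_nonneg _)
        Metric.ball_subset_closedBall.eventuallyLE
    obtain ⟨q, rfl⟩ := b.equivFun.surjective a
    have hq : q = 0 := by
      refine Subtype.ext (eq_zero_of_setIntegral_sq_eq_zero
        (U := Metric.ball (0 : E d) (r / 2)) Metric.isOpen_ball
        (Metric.nonempty_ball.2 (half_pos hr)) Metric.isBounded_ball ?_)
      rw [← h0]
      refine integral_congr_ae (Eventually.of_forall fun x => ?_)
      simp only [Module.Basis.equivFun_apply]
      rw [hfe]
    simp [S, hq] at ha)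
  have hMnn : 0 ≤ M ^ 2 / c := by positivity
  refine ⟨M ^ 2 / c + 1, by positivity, fun p hp x hx => ?_⟩
  have hle : c * ev p x ^ 2 ≤ M ^ 2 * ∫ y in Metric.closedBall (0 : E d) (r / 2), ev p y ^ 2 := by
    set a : Fin (Module.finrank ℝ (Poly d m)) → ℝ := ⇑(b.repr ⟨p, hp⟩)
    have hpa : ∀ y, ev p y = f a y := fun y => (hfe ⟨p, hp⟩ y).symm
    simp only [hpa]
    by_cases h0 : a = 0
    · simp [h0, f]
    have hn : 0 < ‖a‖ := norm_pos_iff.2 h0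
    have hu : ‖a‖⁻¹ • a ∈ S := by simp [S, norm_smul, hn.ne']
    have h1 := hM (‖a‖⁻¹ • a, x) ⟨hu, hx⟩
    have h2 := hcN _ hu
    simp only [Function.uncurry, hfs, Real.norm_eq_abs, mul_pow, integral_const_mul] at h1 h2
    have h3 : (‖a‖⁻¹) ^ 2 * f a x ^ 2 ≤ M ^ 2 := by
      rw [← mul_pow, ← sq_abs]
      exact pow_le_pow_left₀ (abs_nonneg _) h1 2
    have h4 : f a x ^ 2 = ‖a‖ ^ 2 * ((‖a‖⁻¹) ^ 2 * f a x ^ 2) := by field_simp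
    have h5 : (∫ y in Metric.closedBall (0 : E d) (r / 2), f a y ^ 2) = ‖a‖ ^ 2 * ((‖a‖⁻¹) ^ 2 *
      ∫ y in Metric.closedBall (0 : E d) (r / 2), f a y ^ 2) := by field_simp
    rw [h4, h5]
    calc c * (‖a‖ ^ 2 * ((‖a‖⁻¹) ^ 2 * f a x ^ 2)) ≤ c * (‖a‖ ^ 2 * M ^ 2) := by gcongr
      _ = M ^ 2 * (‖a‖ ^ 2 * c) := by ring
      _ ≤ _ := by gcongr
  have hi : IntegrableOn (fun y => ev p y ^ 2) (Metric.ball (0 : E d) r) :=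
    integrableOn_ev_sq Metric.isOpen_ball.measurableSet
      Metric.isBounded_ball Metric.isBounded_ball.measure_lt_top.ne p
  have hle2 : ∫ y in Metric.closedBall (0 : E d) (r / 2), ev p y ^ 2 ≤
      ∫ y in Metric.ball (0 : E d) r, ev p y ^ 2 :=
    setIntegral_mono_set hi (Eventually.of_forall fun _ => sq_nonneg _)
      (Metric.closedBall_subset_ball (half_lt_self hr)).eventuallyLE
  have hnn : 0 ≤ ∫ y in Metric.ball (0 : E d) r, ev p y ^ 2 :=
    integral_nonneg fun _ => sq_nonneg _
  calc ev p x ^ 2 ≤ M ^ 2 / c * ∫ y in Metric.closedBall (0 : E d) (r / 2), ev p y ^ 2 := by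
        rw [div_mul_eq_mul_div, le_div_iff₀ hc]; linarith
    _ ≤ M ^ 2 / c * ∫ y in Metric.ball (0 : E d) r, ev p y ^ 2 := by gcongr
    _ ≤ _ := by rw [add_mul, one_mul]; linarith

open scoped Pointwise in
/-- On polynomials of degree at most `m`, the supremum over a ball is controlled by the mean square
over a concentric ball of comparable radius. -/
lemma exists_sup_sq_le_integral_ball (m : ℕ) {r : ℝ} (hr : 0 < r) :
    ∃ C : ℝ, 0 < C ∧ ∀ (a : E d) (h : ℝ), 0 < h → ∀ p ∈ Poly d m, ∀ x ∈ Metric.closedBall a h,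
      ev p x ^ 2 ≤ C * (h ^ d)⁻¹ * ∫ y in Metric.ball a (r * h), ev p y ^ 2 := by
  obtain ⟨C, hC, H⟩ := exists_sup_sq_le_integral (d := d) m hr
  refine ⟨C, hC, fun a h hh p hp x hx => ?_⟩
  have hx' : h⁻¹ • (x - a) ∈ Metric.closedBall (0 : E d) 1 := by
    rw [mem_closedBall_iff_norm] at hx
    simp only [mem_closedBall_iff_norm, sub_zero, norm_smul, norm_inv, Real.norm_eq_abs,
      abs_of_pos hh]
    rwa [inv_mul_le_iff₀ hh, mul_one]
  have h1 := H _ (rescale_mem_Poly a h hp) _ hx'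
  simp only [ev_rescale, smul_smul, mul_inv_cancel₀ hh.ne', one_smul, add_sub_cancel] at h1
  have h2 := Measure.setIntegral_comp_smul_of_pos (volume : Measure (E d))
    (fun z => ev p (a + z) ^ 2) (Metric.ball 0 r) hh
  have h3 : ∫ z in Metric.ball (0 : E d) (r * h), ev p (a + z) ^ 2 =
      ∫ y in Metric.ball a (r * h), ev p y ^ 2 := by
    rw [← (measurePreserving_add_left volume a).setIntegral_preimage_emb
      (MeasurableEquiv.addLeft a).measurableEmbedding (fun y => ev p y ^ 2)]
    congr 2
    ext z
    simp
  have h4 : h • Metric.ball (0 : E d) r = Metric.ball 0 (r * h) := by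
    rw [smul_ball hh.ne', smul_zero, Real.norm_of_nonneg hh.le, mul_comm]
  rw [h2, h4, h3, finrank_euclideanSpace_fin, smul_eq_mul, ← mul_assoc] at h1
  exact h1

/-! ### The boundary of a star-shaped set -/

/-- Quantitative star-shapedness: if `Y` is star-shaped with respect to all points of the ball
`B(c, r)` and `x`, `y` are boundary points, then `x` is not in the open cone spanned by the ball and
`y`, which lies in the interior of `Y`. -/
lemma le_norm_sub_smul_of_mem_frontier {Y : Set (E d)} {c : E d} {r : ℝ}
    (hY : ∀ z ∈ Metric.ball c r, StarConvex ℝ z Y) {x y : E d} (hx : x ∈ frontier Y)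
    (hy : y ∈ frontier Y) {a : ℝ} (ha0 : 0 ≤ a) (ha1 : a ≤ 1) :
    (1 - a) * r ≤ ‖(x - c) - a • (y - c)‖ := by
  rcases ha1.eq_or_lt with rfl | ha1
  · simp
  by_contra hlt
  have ha : 0 < 1 - a := by linarith
  -- `g (x, y)` is the point `z` with `x = (1 - a) z + a y`; it stays in the ball when `x` and `y` are
  -- perturbed, which puts a neighbourhood of `x` into `Y`
  let g : E d × E d → E d := fun w => (1 - a)⁻¹ • (w.1 - a • w.2)
  have hg : Continuous (g) := by fun_prop
  have hmem : g (x, y) ∈ Metric.ball c r := by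
    rw [mem_ball_iff_norm]
    have : g (x, y) - c = (1 - a)⁻¹ • ((x - c) - a • (y - c)) := by
      have h1 : c = (1 - a)⁻¹ • ((1 - a) • c) := by
        rw [smul_smul, inv_mul_cancel₀ ha.ne', one_smul]
      conv_lhs => rw [h1]
      simp only [g, ← smul_sub]
      congr 1
      module
    rw [this, norm_smul, norm_inv, Real.norm_of_nonneg ha.le, inv_mul_lt_iff₀ ha]
    exact not_le.1 hlt
  have hnhds := (hg.tendsto (x, y)).eventually (Metric.isOpen_ball.mem_nhds hmem)
  rw [nhds_prod_eq] at hnhds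
  obtain ⟨P, hP, Q, hQ, hPQ⟩ := eventually_prod_iff.1 hnhds
  obtain ⟨y', hyQ, hyY⟩ := mem_closure_iff_nhds.1 hy.1 _ hQ
  refine hx.2 (mem_interior_iff_mem_nhds.2 (mem_of_superset hP fun x' hx' => ?_))
  have hz := hPQ hx' hyQ
  have := hY _ hz hyY ha.le ha0 (by ring)
  have he : (1 - a) • g (x', y') + a • y' = x' := by
    simp only [g]
    rw [smul_smul, mul_inv_cancel₀ ha.ne']
    module
  rwa [he] at this

/-- The part of `Y` that is seen from `c` in the directions whose largest coordinate is the `i`-th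
one, with sign `σ = ±1`. -/
def sector (Y : Set (E d)) (c : E d) (i : Fin d) (σ : ℝ) : Set (E d) :=
  {x ∈ Y | x ≠ c ∧ σ * (x i - c i) = |x i - c i| ∧ ∀ j, |x j - c j| ≤ |x i - c i|}

lemma subset_iUnion_sector [NeZero d] {Y : Set (E d)} {c : E d} (hc : c ∉ Y) :
    Y ⊆ ⋃ i, (sector Y c i 1 ∪ sector Y c i (-1)) := by
  intro x hx
  obtain ⟨i, -, hi⟩ := Finset.exists_max_image Finset.univ (fun j => |x j - c j|)
    ⟨0, Finset.mem_univ _⟩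
  have hne : x ≠ c := fun h => hc (h ▸ hx)
  refine mem_iUnion.2 ⟨i, ?_⟩
  rcases le_total 0 (x i - c i) with h | h
  · exact Or.inl ⟨hx, hne, by rw [abs_of_nonneg h, one_mul], fun j => hi j (Finset.mem_univ _)⟩
  · exact Or.inr ⟨hx, hne, by rw [abs_of_nonpos h]; ring, fun j => hi j (Finset.mem_univ _)⟩

/-- The inverse of the central projection of a sector of the boundary of a star-shaped set to a face
of the cube centred at `c` is Lipschitz. -/
lemma dist_le_of_mem_sector {Y : Set (E d)} {c : E d} {r R : ℝ} (hr : 0 < r)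
    (hY : ∀ z ∈ Metric.ball c r, StarConvex ℝ z Y) (hR : Y ⊆ Metric.closedBall c R)
    {i : Fin d} {σ : ℝ} {x y : E d} (hx : x ∈ sector (frontier Y) c i σ)
    (hy : y ∈ sector (frontier Y) c i σ) :
    dist x y ≤ (R + √d * R ^ 2 / r) * √d * dist
      (fun j : {j // j ≠ i} => (x j - c j) / |x i - c i|)
      (fun j : {j // j ≠ i} => (y j - c j) / |y i - c i|) := by
  wlog hst : |x i - c i| ≤ |y i - c i| generalizing x y
  · rw [dist_comm x, dist_comm (fun j : {j // j ≠ i} => (x j - c j) / |x i - c i|)]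
    exact this hy hx (le_of_not_ge hst)
  obtain ⟨hxf, hxc, hxσ, hxm⟩ := hx
  obtain ⟨hyf, hyc, hyσ, hym⟩ := hy
  set s := |x i - c i| with hs
  set t := |y i - c i| with ht
  have hpos : ∀ z : E d, z ≠ c → (∀ j, |z j - c j| ≤ |z i - c i|) → 0 < |z i - c i| := by
    intro z hz hm
    refine lt_of_le_of_ne (abs_nonneg _) fun h0 => hz ?_
    ext j
    have := hm j
    rw [← h0] at this
    exact sub_eq_zero.1 (abs_nonpos_iff.1 this)
  have hs0 : 0 < s := hpos x hxc hxm
  have ht0 : 0 < t := hpos y hyc hym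
  have hyR : ‖y - c‖ ≤ R := by
    have := closure_minimal hR Metric.isClosed_closedBall hyf.1
    rwa [mem_closedBall_iff_norm] at this
  have htR : t ≤ R := le_trans (by simpa using PiLp.norm_apply_le (y - c) i) hyR
  have hsR : s ≤ R := hst.trans htR
  have hRpos : 0 < R := ht0.trans_le htR
  set u := s⁻¹ • (x - c) with hu
  set w := t⁻¹ • (y - c) with hw
  have hxu : x - c = s • u := by rw [hu, smul_smul, mul_inv_cancel₀ hs0.ne', one_smul]
  have hyw : y - c = t • w := by rw [hw, smul_smul, mul_inv_cancel₀ ht0.ne', one_smul]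
  set D := dist (fun j : {j // j ≠ i} => (x j - c j) / s)
      (fun j : {j // j ≠ i} => (y j - c j) / t) with hD
  have hwn : ‖w‖ ≤ √d := by
    rw [EuclideanSpace.norm_eq]
    refine Real.sqrt_le_sqrt ?_
    calc ∑ j, ‖w j‖ ^ 2 ≤ ∑ j : Fin d, (1 : ℝ) := by
          refine Finset.sum_le_sum fun j _ => ?_
          have : ‖w j‖ ≤ 1 := by
            simp only [hw, PiLp.smul_apply, PiLp.sub_apply, smul_eq_mul, norm_mul, norm_inv,
              Real.norm_eq_abs, abs_of_pos ht0]
            rw [inv_mul_le_iff₀ ht0, mul_one]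
            exact hym j
          exact pow_le_one₀ (norm_nonneg _) this
      _ = d := by simp
  have huw : ‖u - w‖ ≤ √d * D := by
    have hD0 : 0 ≤ D := dist_nonneg
    have hsq : √d * D = √(d * D ^ 2) := by rw [Real.sqrt_mul (by simp), Real.sqrt_sq hD0]
    rw [EuclideanSpace.norm_eq, hsq]
    refine Real.sqrt_le_sqrt ?_
    calc ∑ j, ‖(u - w) j‖ ^ 2 ≤ ∑ j : Fin d, D ^ 2 := by
          refine Finset.sum_le_sum fun j _ => pow_le_pow_left₀ (norm_nonneg _) ?_ 2
          by_cases hj : j = i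
          · subst hj
            have : (u - w) j = 0 := by
              simp only [hu, hw, PiLp.smul_apply, PiLp.sub_apply, smul_eq_mul]
              have h1 : s⁻¹ * (σ * (x j - c j)) = 1 := by rw [hxσ, inv_mul_cancel₀ hs0.ne']
              have h2 : t⁻¹ * (σ * (y j - c j)) = 1 := by rw [hyσ, inv_mul_cancel₀ ht0.ne']
              have hσ : σ ≠ 0 := by rintro rfl; simp at h1
              refine (mul_right_inj' hσ).1 ?_
              linarith
            simp [this, D, dist_nonneg]
          · have := dist_le_pi_dist (fun j : {j // j ≠ i} => (x j - c j) / s)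
              (fun j : {j // j ≠ i} => (y j - c j) / t) ⟨j, hj⟩
            rw [dist_eq_norm] at this
            refine le_trans (le_of_eq ?_) this
            simp only [hu, hw, PiLp.smul_apply, PiLp.sub_apply, smul_eq_mul]
            congr 1
            ring
      _ = d * D ^ 2 := by simp
  -- the cone condition, with the ratio of the two radii
  have hcone := le_norm_sub_smul_of_mem_frontier hY hxf hyf (a := s / t) (by positivity)
    ((div_le_one ht0).2 hst)
  have hsub : (x - c) - (s / t) • (y - c) = s • (u - w) := by
    rw [smul_sub s u w, ← hxu, hw, smul_smul, div_eq_mul_inv]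
  rw [hsub, norm_smul, Real.norm_of_nonneg hs0.le] at hcone
  have hts : t - s ≤ R ^ 2 / r * ‖u - w‖ := by
    have h1 : (t - s) * r ≤ s * t * ‖u - w‖ := by
      have : (1 - s / t) * r * t ≤ s * ‖u - w‖ * t := by gcongr
      calc (t - s) * r = (1 - s / t) * r * t := by field_simp
        _ ≤ _ := this
        _ = _ := by ring
    rw [div_mul_eq_mul_div, le_div_iff₀ hr]
    refine h1.trans ?_
    rw [sq]
    gcongr
  have hxy : x - y = s • (u - w) - (t - s) • w := by
    have : x - y = (x - c) - (y - c) := by abel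
    rw [this, hxu, hyw]
    module
  rw [dist_eq_norm, hxy]
  calc ‖s • (u - w) - (t - s) • w‖ ≤ s * ‖u - w‖ + (t - s) * ‖w‖ := by
        refine (norm_sub_le _ _).trans (le_of_eq ?_)
        rw [norm_smul, norm_smul, Real.norm_of_nonneg hs0.le,
          Real.norm_of_nonneg (sub_nonneg.2 hst)]
    _ ≤ R * ‖u - w‖ + (R ^ 2 / r * ‖u - w‖) * √d := by
        have := sub_nonneg.2 hst
        gcongr
    _ = (R + √d * R ^ 2 / r) * ‖u - w‖ := by ring
    _ ≤ (R + √d * R ^ 2 / r) * (√d * D) := by gcongr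
    _ = _ := by ring

lemma surf_apply (s : Set (E d)) :
    surf d s = Measure.addHaarScalarFactor volume (μH[((d - 1 : ℕ) : ℝ)] : Measure (E (d - 1))) *
      μH[((d - 1 : ℕ) : ℝ)] s := rfl

open scoped NNReal ENNReal in
/-- A sector of the boundary of a star-shaped set is a Lipschitz image of a part of a
`(d - 1)`-dimensional cube, which bounds its area. -/
lemma exists_surf_sector_le (d : ℕ) : ∃ A : ℝ≥0, ∀ (Y : Set (E d)) (c : E d) (r R : ℝ)
    (i : Fin d) (σ : ℝ), 0 < r → 0 ≤ R →
    (∀ z ∈ Metric.ball c r, StarConvex ℝ z Y) → Y ⊆ Metric.closedBall c R →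
    surf d (sector (frontier Y) c i σ) ≤
      A * ENNReal.ofReal ((R + √d * R ^ 2 / r) * √d) ^ (d - 1) := by
  refine ⟨Measure.addHaarScalarFactor volume (μH[((d - 1 : ℕ) : ℝ)] : Measure (E (d - 1)))
    * 2 ^ (d - 1), fun Y c r R i σ hr hR0 hY hR => ?_⟩
  let ψ : E d → ({j // j ≠ i} → ℝ) := fun x j => (x j - c j) / |x i - c i|
  set S := sector (frontier Y) c i σ
  set k := (R + √d * R ^ 2 / r) * √d
  have hk : 0 ≤ k := by positivity
  have hdist : ∀ x ∈ S, ∀ y ∈ S, dist x y ≤ k * dist (ψ x) (ψ y) := fun x hx y hy =>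
    dist_le_of_mem_sector hr hY hR hx hy
  have hinj : InjOn ψ S := by
    intro x hx y hy hxy
    have := hdist x hx y hy
    rw [hxy, dist_self, mul_zero] at this
    exact dist_le_zero.1 this
  have hlip : LipschitzOnWith k.toNNReal (Function.invFunOn ψ S) (ψ '' S) := by
    refine LipschitzOnWith.of_dist_le_mul ?_
    rintro _ ⟨x, hx, rfl⟩ _ ⟨y, hy, rfl⟩
    rw [hinj.leftInvOn_invFunOn hx, hinj.leftInvOn_invFunOn hy, Real.coe_toNNReal _ hk]
    exact hdist x hx y hy
  have hcard : Fintype.card {j // j ≠ i} = d - 1 := by simp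
  have h1 := hlip.hausdorffMeasure_image_le (d := ((d - 1 : ℕ) : ℝ)) (Nat.cast_nonneg _)
  have himg : Function.invFunOn ψ S '' (ψ '' S) = S := by
    rw [image_image]
    exact (image_congr fun x hx => hinj.leftInvOn_invFunOn hx).trans (image_id' S)
  have h2 : (μH[((d - 1 : ℕ) : ℝ)] : Measure ({j // j ≠ i} → ℝ)) (ψ '' S) ≤ 2 ^ (d - 1) := by
    have : (μH[((d - 1 : ℕ) : ℝ)] : Measure ({j // j ≠ i} → ℝ)) = volume := by
      rw [← hcard, hausdorffMeasure_pi_real]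
    rw [this]
    calc volume (ψ '' S) ≤ volume (Metric.closedBall (0 : {j // j ≠ i} → ℝ) 1) := by
          refine measure_mono ?_
          rintro _ ⟨x, hx, rfl⟩
          rw [mem_closedBall_zero_iff, pi_norm_le_iff_of_nonneg zero_le_one]
          intro j
          rw [Real.norm_eq_abs, abs_div, abs_abs]
          exact div_le_one_of_le₀ (hx.2.2.2 j) (abs_nonneg _)
      _ = 2 ^ (d - 1) := by
          rw [Real.volume_pi_closedBall _ zero_le_one, hcard]
          simp
  rw [himg] at h1
  rw [surf_apply]
  refine (mul_le_mul_right (h1.trans (mul_le_mul_right h2 _)) _).trans (le_of_eq ?_)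
  rw [ENNReal.rpow_natCast]
  push_cast
  rw [ENNReal.ofReal]
  ring

/-- A non-empty bounded open set that is connected by star-shaped sets contains a ball of radius
comparable to its diameter, and it is the union of boundedly many sets, each star-shaped with
respect to a ball of radius comparable to the diameter of the whole set. -/
lemma IsConnectedByStarShaped.exists_uniform_balls (hd : 2 ≤ d) {ϱ : ℝ} (hϱ : 0 < ϱ)
    {T : Set (E d)} (hT : IsOpen T) (hne : T.Nonempty) (hb : Bornology.IsBounded T)
    (h : IsConnectedByStarShaped ϱ T) :
    0 < Metric.diam T ∧
    (∃ c, Metric.ball c (ϱ ^ 2 / 2 * Metric.diam T) ⊆ T) ∧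
    ∃ (N : ℕ) (Y : Fin N → Set (E d)), (N : ℝ) ≤ ϱ⁻¹ ∧ T = ⋃ i, Y i ∧
      ∀ i, ∃ c ∈ Y i, ∀ z ∈ Metric.ball c (ϱ ^ 2 / 2 * Metric.diam T), StarConvex ℝ z (Y i) := by
  have : Nonempty (Fin d) := ⟨⟨0, by omega⟩⟩
  obtain ⟨N, Y, hN, hTY, hstar, hchain⟩ := h
  have hspan : affineSpan ℝ T = ⊤ := hT.affineSpan_eq_top hne
  have hball : ∀ c r, relBall T c r = Metric.ball c r := by
    intro c r; simp [relBall, hspan]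
  have hd_ball : ∀ (c : E d) (r : ℝ), 0 < r → ∀ S : Set (E d), Bornology.IsBounded S →
      Metric.ball c r ⊆ S → r / 2 ≤ Metric.diam S := by
    intro c r hr S hS hcS
    let i : Fin d := ⟨0, by omega⟩
    have h1 : c + EuclideanSpace.single i (r / 2) ∈ Metric.ball c r := by
      rw [mem_ball_iff_norm]
      simp only [add_sub_cancel_left, PiLp.norm_single, Real.norm_eq_abs]
      rw [abs_of_pos (by positivity)]; linarith
    have h2 := Metric.dist_le_diam_of_mem hS (hcS h1) (hcS (Metric.mem_ball_self hr))
    rw [dist_eq_norm] at h2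
    simp only [add_sub_cancel_left, PiLp.norm_single, Real.norm_eq_abs] at h2
    rwa [abs_of_pos (by positivity)] at h2
  have hdiam : 0 < Metric.diam T := by
    obtain ⟨x, hx⟩ := hne
    obtain ⟨ε, hε, hεT⟩ := Metric.isOpen_iff.1 hT x hx
    exact (half_pos hε).trans_le (hd_ball x ε hε T hb hεT)
  have hYT : ∀ i, Y i ⊆ T := fun i => hTY ▸ subset_iUnion Y i
  have hYb : ∀ i, Bornology.IsBounded (Y i) := fun i => hb.subset (hYT i)
  have hNpos : 0 < N := by
    rcases Nat.eq_zero_or_pos N with rfl | h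
    · rw [hTY] at hne; simp at hne
    · exact h
  have hϱ1 : ϱ ≤ 1 := by
    have : (1 : ℝ) ≤ N := by exact_mod_cast hNpos
    exact (one_le_inv₀ hϱ).1 (this.trans hN)
  -- every piece has a diameter comparable to that of the whole set
  have hYd : ∀ i, (Y i).Nonempty ∧ ϱ / 2 * Metric.diam T ≤ Metric.diam (Y i) := by
    intro i
    by_cases hex : ∃ j, i ≠ j
    · obtain ⟨j, hij⟩ := hex
      rcases (Relation.ReflTransGen.cases_head_iff.1 (hchain i j)) with h | ⟨a, ⟨c, -, hc⟩, -⟩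
      · exact absurd h hij
      · rw [hball] at hc
        have hpos : 0 < ϱ * Metric.diam T := by positivity
        have hcY : Metric.ball c (ϱ * Metric.diam T) ⊆ Y i := hc.trans inter_subset_left
        refine ⟨⟨c, hcY (Metric.mem_ball_self hpos)⟩, ?_⟩
        have := hd_ball c _ hpos (Y i) (hYb i) hcY
        linarith
    · push Not at hex
      have hTi : T = Y i := by
        rw [hTY]
        refine Subset.antisymm (iUnion_subset fun j => ?_) (subset_iUnion Y i)
        rw [hex j]
      rw [← hTi]
      exact ⟨hne, by nlinarith⟩
  have hmain : ∀ i, ∃ c ∈ Y i, ∀ z ∈ Metric.ball c (ϱ ^ 2 / 2 * Metric.diam T),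
      StarConvex ℝ z (Y i) := by
    intro i
    obtain ⟨c, -, hc⟩ := hstar i
    rw [hball] at hc
    have hle : ϱ ^ 2 / 2 * Metric.diam T ≤ ϱ * Metric.diam (Y i) := by
      calc ϱ ^ 2 / 2 * Metric.diam T = ϱ * (ϱ / 2 * Metric.diam T) := by ring
        _ ≤ _ := by gcongr; exact (hYd i).2
    have hc' := fun z hz => hc z (Metric.ball_subset_ball hle hz)
    exact ⟨c, (hc' c (Metric.mem_ball_self (by positivity))).mem (hYd i).1, hc'⟩
  refine ⟨hdiam, ?_, N, Y, hN, hTY, hmain⟩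
  obtain ⟨c, -, hc⟩ := hmain ⟨0, hNpos⟩
  exact ⟨c, fun z hz => hYT _ ((hc z hz).mem (hYd _).1)⟩

open scoped NNReal ENNReal in
/-- The boundary of a set of diameter `h` that is connected by star-shaped sets has area at most a
constant times `h ^ (d - 1)`. -/
lemma exists_surf_frontier_le (hd : 2 ≤ d) {ϱ : ℝ} (hϱ : 0 < ϱ) :
    ∃ A : ℝ, 0 ≤ A ∧ ∀ T : Set (E d), IsOpen T → T.Nonempty → Bornology.IsBounded T →
      IsConnectedByStarShaped ϱ T →
      surf d (frontier T) ≤ ENNReal.ofReal (A * Metric.diam T ^ (d - 1)) := by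
  have : NeZero d := ⟨by omega⟩
  obtain ⟨A, hA⟩ := exists_surf_sector_le d
  let B : ℝ := (1 + √d * (2 / ϱ ^ 2)) * √d
  refine ⟨ϱ⁻¹ * (d * (2 * (A * B ^ (d - 1)))), by positivity, fun T hT hne hb hreg => ?_⟩
  obtain ⟨hpos, -, N, Y, hN, hTY, hY⟩ := hreg.exists_uniform_balls hd hϱ hT hne hb
  set h := Metric.diam T
  have hsec : ∀ i, surf d (frontier (Y i)) ≤
      d * (2 * (A * ENNReal.ofReal (B * h) ^ (d - 1))) := by
    intro i
    obtain ⟨c, hcY, hc⟩ := hY i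
    have hr : 0 < ϱ ^ 2 / 2 * h := by positivity
    have hcT : c ∈ T := hTY ▸ mem_iUnion.2 ⟨i, hcY⟩
    have hYR : Y i ⊆ Metric.closedBall c h := fun x hx =>
      Metric.dist_le_diam_of_mem hb (hTY ▸ mem_iUnion.2 ⟨i, hx⟩) hcT
    have hcf : c ∉ frontier (Y i) := fun hf => by
      refine hf.2 (mem_interior_iff_mem_nhds.2 (mem_of_superset (Metric.ball_mem_nhds c hr) ?_))
      exact fun z hz => (hc z hz).mem ⟨c, hcY⟩
    have hs : ∀ j σ, surf d (sector (frontier (Y i)) c j σ) ≤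
        A * ENNReal.ofReal (B * h) ^ (d - 1) := by
      intro j σ
      have := hA (Y i) c _ h j σ hr hpos.le hc hYR
      convert this using 4
      simp only [B]
      field_simp
    calc surf d (frontier (Y i))
        ≤ ∑ j, surf d (sector (frontier (Y i)) c j 1 ∪ sector (frontier (Y i)) c j (-1)) :=
          (measure_mono (subset_iUnion_sector hcf)).trans (measure_iUnion_fintype_le _ _)
      _ ≤ ∑ _j : Fin d, 2 * (A * ENNReal.ofReal (B * h) ^ (d - 1)) := by
          refine Finset.sum_le_sum fun j _ => (measure_union_le _ _).trans ?_
          rw [two_mul]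
          exact add_le_add (hs j 1) (hs j (-1))
      _ = _ := by simp
  have hfr : frontier T ⊆ ⋃ i, frontier (Y i) := by
    intro x hx
    have hx1 : x ∈ ⋃ i, closure (Y i) := by
      rw [← closure_iUnion_of_finite, ← hTY]; exact hx.1
    obtain ⟨i, hi⟩ := mem_iUnion.1 hx1
    exact mem_iUnion.2 ⟨i, hi, fun hint => hx.2 (interior_mono (hTY ▸ subset_iUnion Y i) hint)⟩
  have hB : 0 ≤ B := by positivity
  calc surf d (frontier T) ≤ ∑ i, surf d (frontier (Y i)) :=
        (measure_mono hfr).trans (measure_iUnion_fintype_le _ _)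
    _ ≤ ∑ _i : Fin N, (d : ℝ≥0∞) * (2 * (A * ENNReal.ofReal (B * h) ^ (d - 1))) :=
        Finset.sum_le_sum fun i _ => hsec i
    _ = ENNReal.ofReal (N * (d * (2 * (A * (B * h) ^ (d - 1))))) := by
        have hBh : 0 ≤ B * h := by positivity
        rw [ENNReal.ofReal_mul (Nat.cast_nonneg N), ENNReal.ofReal_mul (Nat.cast_nonneg d),
          ENNReal.ofReal_mul zero_le_two, ENNReal.ofReal_mul A.coe_nonneg,
          ENNReal.ofReal_pow hBh]
        simp
    _ ≤ _ := by
        refine ENNReal.ofReal_le_ofReal ?_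
        calc (N : ℝ) * (d * (2 * (A * (B * h) ^ (d - 1))))
            ≤ ϱ⁻¹ * (d * (2 * (A * (B * h) ^ (d - 1)))) := by gcongr
          _ = _ := by rw [mul_pow]; ring

/-! ### Existence of projections and potentials -/

/-- A symmetric bilinear form on a finite-dimensional space represents every functional that
vanishes on its kernel. -/
lemma exists_eq_of_vanish_on_ker {V : Type*} [AddCommGroup V] [Module ℝ V] [FiniteDimensional ℝ V]
    (B : V →ₗ[ℝ] V →ₗ[ℝ] ℝ) (hB : ∀ u v, B u v = B v u) (L : V →ₗ[ℝ] ℝ)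
    (hL : ∀ w, B w = 0 → L w = 0) : ∃ q, B q = L := by
  have h := Subspace.dualCoannihilator_dualAnnihilator_eq (W := LinearMap.range B)
  have : L ∈ LinearMap.range B := by
    rw [← h, Submodule.mem_dualAnnihilator]
    intro w hw
    rw [Submodule.mem_dualCoannihilator] at hw
    exact hL w (LinearMap.ext fun q => by rw [hB]; exact hw _ ⟨q, rfl⟩)
  exact this

/-- The defining properties of the `L²(μ)`-orthogonal projection. -/
lemma l2Proj_spec {μ : Measure (E d)} (hμ : ∀ p : MvPolynomial (Fin d) ℝ, Integrable (ev p) μ)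
    (m : ℕ) {g : E d → ℝ} (hg : ∀ w : MvPolynomial (Fin d) ℝ, Integrable (fun x => g x * ev w x) μ) :
    l2Proj μ m g ∈ Poly d m ∧
      ∀ w ∈ Poly d m, ∫ x, ev (l2Proj μ m g) x * ev w x ∂μ = ∫ x, g x * ev w x ∂μ := by
  have hμ2 : ∀ p q : MvPolynomial (Fin d) ℝ, Integrable (fun x => ev p x * ev q x) μ := by
    intro p q
    simpa only [← ev_mul] using hμ (p * q)
  let B : Poly d m →ₗ[ℝ] Poly d m →ₗ[ℝ] ℝ := LinearMap.mk₂ ℝ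
    (fun p q => ∫ x, ev p.1 x * ev q.1 x ∂μ)
    (fun p p' q => by
      simp only [Submodule.coe_add, ev_add, add_mul]
      exact integral_add (hμ2 _ _) (hμ2 _ _))
    (fun c p q => by
      simp only [Submodule.coe_smul, ev_smul, mul_assoc, integral_const_mul, smul_eq_mul])
    (fun p q q' => by
      simp only [Submodule.coe_add, ev_add, mul_add]
      exact integral_add (hμ2 _ _) (hμ2 _ _))
    (fun c p q => by
      simp only [Submodule.coe_smul, ev_smul, mul_left_comm _ c, integral_const_mul, smul_eq_mul])
  let L : Poly d m →ₗ[ℝ] ℝ :=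
    { toFun := fun w => ∫ x, g x * ev w.1 x ∂μ
      map_add' := fun p q => by
        simp only [Submodule.coe_add, ev_add, mul_add]
        exact integral_add (hg _) (hg _)
      map_smul' := fun c p => by
        simp only [Submodule.coe_smul, ev_smul, mul_left_comm _ c, integral_const_mul, smul_eq_mul,
          RingHom.id_apply] }
  obtain ⟨q, hq⟩ := exists_eq_of_vanish_on_ker B
    (fun u v => by simp only [B, LinearMap.mk₂_apply, mul_comm]) L (fun w hw => by
      have h0 : B w w = 0 := by rw [hw]; rfl
      simp only [B, LinearMap.mk₂_apply] at h0
      rw [integral_eq_zero_iff_of_nonneg (fun x => mul_self_nonneg _) (hμ2 _ _)] at h0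
      refine integral_eq_zero_of_ae (h0.mono fun x hx => ?_)
      have : ev w.1 x = 0 := mul_self_eq_zero.1 hx
      simp [this])
  have hex : ∃ q, q ∈ Poly d m ∧ ∀ w ∈ Poly d m,
      ∫ x, ev q x * ev w x ∂μ = ∫ x, g x * ev w x ∂μ :=
    ⟨q.1, q.2, fun w hw => LinearMap.congr_fun hq ⟨w, hw⟩⟩
  exact Classical.epsilon_spec hex

/-- The polynomial `K∇p · ∇w`. -/
def energyPoly (K : Matrix (Fin d) (Fin d) ℝ) (p w : MvPolynomial (Fin d) ℝ) :
    MvPolynomial (Fin d) ℝ :=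
  ∑ i, ∑ j, K i j • (MvPolynomial.pderiv j p * MvPolynomial.pderiv i w)

lemma ev_energyPoly (K : Matrix (Fin d) (Fin d) ℝ) (p w : MvPolynomial (Fin d) ℝ) (x : E d) :
    (K *ᵥ grad p x) ⬝ᵥ grad w x = ev (energyPoly K p w) x := by
  simp only [energyPoly, ev_sum, ev_smul, ev_mul, dotProduct, Matrix.mulVec, grad, Finset.sum_mul,
    mul_assoc]

/-- The polynomial `∇ · (K∇w)`. -/
def divGradPoly (K : Matrix (Fin d) (Fin d) ℝ) : MvPolynomial (Fin d) ℝ →ₗ[ℝ]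
    MvPolynomial (Fin d) ℝ :=
  ∑ i, ∑ j, K i j • ((MvPolynomial.pderiv i).toLinearMap ∘ₗ (MvPolynomial.pderiv j).toLinearMap)

lemma ev_divGradPoly (K : Matrix (Fin d) (Fin d) ℝ) (w : MvPolynomial (Fin d) ℝ) (x : E d) :
    divGrad K w x = ev (divGradPoly K w) x := by
  simp [divGrad, divGradPoly]

/-- The polynomial `K∇w · n`. -/
def fluxPoly (K : Matrix (Fin d) (Fin d) ℝ) (n : Fin d → ℝ) : MvPolynomial (Fin d) ℝ →ₗ[ℝ]
    MvPolynomial (Fin d) ℝ :=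
  ∑ i, ∑ j, (n i * K i j) • (MvPolynomial.pderiv j).toLinearMap

lemma ev_fluxPoly (K : Matrix (Fin d) (Fin d) ℝ) (n : Fin d → ℝ) (w : MvPolynomial (Fin d) ℝ)
    (x : E d) : (K *ᵥ grad w x) ⬝ᵥ n = ev (fluxPoly K n w) x := by
  simp only [fluxPoly, dotProduct, Matrix.mulVec, grad, Finset.sum_mul, LinearMap.sum_apply, ev_sum,
    LinearMap.smul_apply, ev_smul]
  refine Finset.sum_congr rfl fun i _ => Finset.sum_congr rfl fun j _ => ?_
  simp only [Derivation.coeFn_coe]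
  ring

lemma divGradPoly_eq_zero (K : Matrix (Fin d) (Fin d) ℝ) {w : MvPolynomial (Fin d) ℝ}
    (hw : ∀ i, MvPolynomial.pderiv i w = 0) : divGradPoly K w = 0 := by
  simp [divGradPoly, hw]

lemma fluxPoly_eq_zero (K : Matrix (Fin d) (Fin d) ℝ) (n : Fin d → ℝ)
    {w : MvPolynomial (Fin d) ℝ} (hw : ∀ i, MvPolynomial.pderiv i w = 0) : fluxPoly K n w = 0 := by
  simp [fluxPoly, hw]

/-- `∫_T |∇p|²`. -/
def gradSq (T : Set (E d)) (p : MvPolynomial (Fin d) ℝ) : ℝ :=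
  ∑ i, ∫ x in T, ev (MvPolynomial.pderiv i p) x ^ 2

lemma gradSq_nonneg (T : Set (E d)) (p : MvPolynomial (Fin d) ℝ) : 0 ≤ gradSq T p :=
  Finset.sum_nonneg fun _ _ => integral_nonneg fun _ => sq_nonneg _

lemma integrable_ev_restrict {T : Set (E d)} (hT : IsOpen T) (hb : Bornology.IsBounded T)
    (p : MvPolynomial (Fin d) ℝ) : Integrable (ev p) (volume.restrict T) :=
  integrableOn_ev hT.measurableSet hb hb.measure_lt_top.ne p

lemma integrable_ev_mul_restrict {T : Set (E d)} (hT : IsOpen T) (hb : Bornology.IsBounded T)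
    (p q : MvPolynomial (Fin d) ℝ) :
    Integrable (fun x => ev p x * ev q x) (volume.restrict T) := by
  simpa only [← ev_mul] using integrable_ev_restrict hT hb (p * q)

/-- Ellipticity in integrated form. -/
lemma mul_gradSq_le_energy {T : Set (E d)} (hT : IsOpen T) (hb : Bornology.IsBounded T)
    {K : Matrix (Fin d) (Fin d) ℝ} {Klo : ℝ}
    (hK : ∀ x : Fin d → ℝ, Klo * (x ⬝ᵥ x) ≤ (K *ᵥ x) ⬝ᵥ x) (p : MvPolynomial (Fin d) ℝ) :
    Klo * gradSq T p ≤ ∫ x in T, (K *ᵥ grad p x) ⬝ᵥ grad p x := by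
  have hi : ∀ i, Integrable (fun x => ev (MvPolynomial.pderiv i p) x ^ 2) (volume.restrict T) :=
    fun i => integrableOn_ev_sq hT.measurableSet hb hb.measure_lt_top.ne _
  unfold gradSq
  rw [← integral_finsetSum _ (fun i _ => hi i), ← integral_const_mul]
  refine integral_mono ((integrable_finsetSum _ fun i _ => hi i).const_mul _) ?_ fun x => ?_
  · simp only [ev_energyPoly]
    exact integrable_ev_restrict hT hb _
  · refine le_trans (le_of_eq ?_) (hK (grad p x))
    simp only [dotProduct, grad, sq]

lemma integrable_facePoly_mul {k : ℕ} {𝓕 : Finset (Set (E d))} (g : FacePoly k 𝓕) {F : Set (E d)}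
    (hF : F ∈ 𝓕) (hm : MeasurableSet F) (hb : Bornology.IsBounded F) (hf : surf d F ≠ ⊤)
    (w : MvPolynomial (Fin d) ℝ) :
    Integrable (fun x => g.1 x * ev w x) ((surf d).restrict F) := by
  obtain ⟨q, -, hq⟩ := g.2 F hF
  refine IntegrableOn.congr_fun (integrableOn_ev hm hb hf (q * w)) (fun x hx => ?_) hm
  rw [ev_mul, hq hx]

/-- The local Neumann problem that defines the potential reconstruction is solvable: its right-hand
side vanishes on constants, which are the kernel of the energy form. -/
lemma exists_isPotential {T : Set (E d)} (hT : IsOpen T) (hne : T.Nonempty)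
    (hb : Bornology.IsBounded T) {𝓕 : Finset (Set (E d))}
    (h𝓕 : ∀ F ∈ 𝓕, MeasurableSet F ∧ Bornology.IsBounded F ∧ surf d F ≠ ⊤)
    {K : Matrix (Fin d) (Fin d) ℝ} (hsymm : K.IsSymm) {Klo : ℝ} (hlo : 0 < Klo)
    (hK : ∀ x : Fin d → ℝ, Klo * (x ⬝ᵥ x) ≤ (K *ᵥ x) ⬝ᵥ x) {k l : ℕ} (v : LocalSpace 𝓕 k l) :
    ∃ p, IsPotential T 𝓕 K v p := by
  have hen : ∀ p w, Integrable (ev (energyPoly K p w)) (volume.restrict T) :=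
    fun p w => integrable_ev_restrict hT hb _
  have hv : ∀ F ∈ 𝓕, ∀ w : MvPolynomial (Fin d) ℝ,
      Integrable (fun x => v.2.1 x * ev w x) ((surf d).restrict F) := fun F hF w =>
    integrable_facePoly_mul v.2 hF (h𝓕 F hF).1 (h𝓕 F hF).2.1 (h𝓕 F hF).2.2 w
  let B : Poly d (k + 1) →ₗ[ℝ] Poly d (k + 1) →ₗ[ℝ] ℝ := LinearMap.mk₂ ℝ
    (fun p q => ∫ x in T, ev (energyPoly K p.1 q.1) x)
    (fun p p' q => by
      rw [← integral_add (hen _ _) (hen _ _)]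
      simp only [energyPoly, ← ev_add, ← Finset.sum_add_distrib, ← smul_add, ← add_mul, ← map_add,
        Submodule.coe_add])
    (fun c p q => by
      rw [smul_eq_mul, ← integral_const_mul]
      simp only [energyPoly, Submodule.coe_smul, Derivation.map_smul, smul_mul_assoc, ← ev_smul,
        Finset.smul_sum, smul_comm c])
    (fun p q q' => by
      rw [← integral_add (hen _ _) (hen _ _)]
      simp only [energyPoly, ← ev_add, ← Finset.sum_add_distrib, ← smul_add, ← mul_add, ← map_add,
        Submodule.coe_add])
    (fun c p q => by
      rw [smul_eq_mul, ← integral_const_mul]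
      simp only [energyPoly, Submodule.coe_smul, Derivation.map_smul, mul_smul_comm, ← ev_smul,
        Finset.smul_sum, smul_comm c])
  let L : Poly d (k + 1) →ₗ[ℝ] ℝ :=
    { toFun := fun w => -(∫ x in T, ev v.1.1 x * ev (divGradPoly K w.1) x) +
        ∑ F ∈ 𝓕, ∫ x in F, v.2.1 x * ev (fluxPoly K (outwardNormal T F).ofLp w.1) x ∂(surf d)
      map_add' := fun p q => by
        simp only [Submodule.coe_add, map_add, ev_add, mul_add]
        rw [integral_add (integrable_ev_mul_restrict hT hb _ _)
          (integrable_ev_mul_restrict hT hb _ _), Finset.sum_congr rfl fun F hF =>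
          integral_add (hv F hF (fluxPoly K (outwardNormal T F).ofLp p.1))
            (hv F hF (fluxPoly K (outwardNormal T F).ofLp q.1)), Finset.sum_add_distrib]
        ring
      map_smul' := fun c p => by
        simp only [Submodule.coe_smul, map_smul, ev_smul, mul_left_comm _ c, integral_const_mul,
          smul_eq_mul, RingHom.id_apply, ← Finset.mul_sum]
        ring }
  have hsym : ∀ p q, energyPoly K p q = energyPoly K q p := by
    intro p q
    unfold energyPoly
    rw [Finset.sum_comm]
    refine Finset.sum_congr rfl fun i _ => Finset.sum_congr rfl fun j _ => ?_
    rw [hsymm.apply i j, mul_comm]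
  obtain ⟨q, hq⟩ := exists_eq_of_vanish_on_ker B
    (fun u w => by simp only [B, LinearMap.mk₂_apply, hsym u.1]) L (fun w hw => by
      have h0 : B w w = 0 := by rw [hw]; rfl
      simp only [B, LinearMap.mk₂_apply, ← ev_energyPoly] at h0
      have h1 := mul_gradSq_le_energy hT hb hK w.1
      rw [h0] at h1
      have h2 : gradSq T w.1 = 0 := le_antisymm (nonpos_of_mul_nonpos_right h1 hlo)
        (gradSq_nonneg _ _)
      have h3 : ∀ i, MvPolynomial.pderiv i w.1 = 0 := fun i =>
        eq_zero_of_setIntegral_sq_eq_zero hT hne hb ((Finset.sum_eq_zero_iff_of_nonneg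
          fun _ _ => integral_nonneg fun _ => sq_nonneg _).1 h2 i (Finset.mem_univ i))
      simp [L, divGradPoly_eq_zero K h3, fluxPoly_eq_zero K _ h3])
  -- the additive constant is fixed by the mean value condition
  let c : ℝ := (∫ x in T, (ev v.1.1 x - ev q.1 x)) / volume.real T
  have hvol : 0 < volume.real T :=
    ENNReal.toReal_pos (hT.measure_pos _ hne).ne' hb.measure_lt_top.ne
  refine ⟨q.1 + MvPolynomial.C c, add_mem q.2 (C_mem_Poly _ _), fun w hw => ?_, ?_⟩
  · have hg : ∀ x, grad (q.1 + MvPolynomial.C c) x = grad q.1 x := by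
      intro x; ext i; simp [grad]
    simp only [hg, ev_energyPoly]
    simp only [ev_divGradPoly, ev_fluxPoly]
    exact LinearMap.congr_fun hq ⟨w, hw⟩
  · simp only [ev_add, ev_C, ← sub_sub]
    rw [integral_sub (f := fun x => ev v.1.1 x - ev q.1 x)]
    · simp only [integral_const, measureReal_restrict_apply_univ, smul_eq_mul, c]
      field_simp
      ring
    · exact (integrable_ev_restrict hT hb _).sub (integrable_ev_restrict hT hb _)
    · exact (integrable_ev_restrict hT hb (MvPolynomial.C c)).congr (ae_of_all _ fun x => ev_C c x)

/-! ### Trace and Poincaré inequalities for polynomials -/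

/-- Discrete trace inequality. The faces may be arbitrarily small and numerous: only their total
area enters. -/
lemma exists_trace_const (hd : 2 ≤ d) {ϱ : ℝ} (hϱ : 0 < ϱ) (m : ℕ) :
    ∃ C : ℝ, 0 ≤ C ∧ ∀ T : Set (E d), IsOpen T → T.Nonempty → Bornology.IsBounded T →
      IsConnectedByStarShaped ϱ T → ∀ 𝓕 : Finset (Set (E d)),
      (∀ F ∈ 𝓕, MeasurableSet F ∧ F ⊆ frontier T) →
      (𝓕 : Set (Set (E d))).PairwiseDisjoint id → ∀ p ∈ Poly d m,
      ∑ F ∈ 𝓕, ∫ x in F, ev p x ^ 2 ∂(surf d) ≤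
        C * (Metric.diam T)⁻¹ * ∫ x in T, ev p x ^ 2 := by
  obtain ⟨A, hA0, hA⟩ := exists_surf_frontier_le hd hϱ
  obtain ⟨C, hC, H⟩ := exists_sup_sq_le_integral_ball (d := d) m (r := ϱ ^ 2 / 2) (by positivity)
  refine ⟨C * A, by positivity, fun T hT hne hb hreg 𝓕 h𝓕 hdisj p hp => ?_⟩
  obtain ⟨hpos, ⟨c, hc⟩, -⟩ := hreg.exists_uniform_balls hd hϱ hT hne hb
  have hA' := hA T hT hne hb hreg
  set h := Metric.diam T
  have hcT : c ∈ T := hc (Metric.mem_ball_self (by positivity))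
  have hcl : frontier T ⊆ Metric.closedBall c h := frontier_subset_closure.trans
    (closure_minimal (fun x hx => Metric.dist_le_diam_of_mem hb hx hcT) Metric.isClosed_closedBall)
  set J := ∫ x in T, ev p x ^ 2
  have hJ : 0 ≤ J := integral_nonneg fun _ => sq_nonneg _
  have hsup : ∀ x ∈ frontier T, ev p x ^ 2 ≤ C * (h ^ d)⁻¹ * J := fun x hx => by
    refine (H c h hpos p hp x (hcl hx)).trans ?_
    gcongr
    exact setIntegral_mono_set (integrableOn_ev_sq hT.measurableSet hb hb.measure_lt_top.ne p)
      (Eventually.of_forall fun _ => sq_nonneg _) hc.eventuallyLE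
  have hfin : surf d (frontier T) ≠ ⊤ := (hA'.trans_lt ENNReal.ofReal_lt_top).ne
  have hface : ∀ F ∈ 𝓕, ∫ x in F, ev p x ^ 2 ∂(surf d) ≤
      C * (h ^ d)⁻¹ * J * (surf d).real F := by
    intro F hF
    obtain ⟨hm, hsub⟩ := h𝓕 F hF
    have hFt : surf d F < ⊤ := (measure_mono hsub).trans_lt hfin.lt_top
    refine (Real.le_norm_self _).trans (norm_setIntegral_le_of_norm_le_const hFt fun x hx => ?_)
    rw [Real.norm_of_nonneg (sq_nonneg _)]
    exact hsup x (hsub hx)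
  have hsum : ∑ F ∈ 𝓕, (surf d).real F ≤ A * h ^ (d - 1) := by
    have h1 : ∑ F ∈ 𝓕, surf d F ≤ surf d (frontier T) := by
      refine (measure_biUnion_finset (μ := surf d) (f := id) hdisj
        fun F hF => (h𝓕 F hF).1).symm.trans_le ?_
      exact measure_mono (iUnion₂_subset fun F hF => (h𝓕 F hF).2)
    have h2 : ∑ F ∈ 𝓕, (surf d).real F = (∑ F ∈ 𝓕, surf d F).toReal :=
      (ENNReal.toReal_sum fun F hF => ((measure_mono (h𝓕 F hF).2).trans_lt hfin.lt_top).ne).symm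
    rw [h2]
    exact ENNReal.toReal_le_of_le_ofReal (by positivity) (h1.trans hA')
  calc ∑ F ∈ 𝓕, ∫ x in F, ev p x ^ 2 ∂(surf d)
      ≤ ∑ F ∈ 𝓕, C * (h ^ d)⁻¹ * J * (surf d).real F := Finset.sum_le_sum hface
    _ = C * (h ^ d)⁻¹ * J * ∑ F ∈ 𝓕, (surf d).real F := by rw [Finset.mul_sum]
    _ ≤ C * (h ^ d)⁻¹ * J * (A * h ^ (d - 1)) := by gcongr
    _ = _ := by
      have : h ^ d = h ^ (d - 1) * h := by rw [← pow_succ]; congr 1; omega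
      rw [this]
      field_simp

lemma hasDerivAt_ev_line (p : MvPolynomial (Fin d) ℝ) (a u : E d) (t : ℝ) :
    HasDerivAt (fun s : ℝ => ev p (a + s • u))
      (∑ i, ev (MvPolynomial.pderiv i p) (a + t • u) * u i) t := by
  induction p using MvPolynomial.induction_on with
  | C c => simpa using hasDerivAt_const t c
  | add p q hp hq =>
    refine (hp.add hq).congr_deriv ?_ |>.congr_of_eventuallyEq (.of_forall fun s => ?_)
    · simp only [ev_add, map_add, add_mul, Finset.sum_add_distrib]
    · simp
  | mul_X p j hp =>
    have hX : HasDerivAt (fun s : ℝ => ev (MvPolynomial.X j) (a + s • u)) (u j) t := by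
      simpa [ev] using ((hasDerivAt_id t).mul_const (u j)).const_add (a j)
    refine (hp.mul hX).congr_deriv ?_ |>.congr_of_eventuallyEq (.of_forall fun s => ?_)
    · symm
      simp only [MvPolynomial.pderiv_mul, ev_add, ev_mul, add_mul, Finset.sum_add_distrib,
        Finset.sum_mul]
      congr 1
      · exact Finset.sum_congr rfl fun i _ => by ring
      · rw [Finset.sum_eq_single j]
        · simp [ev]
        · intro i _ hij
          simp [MvPolynomial.pderiv_X_of_ne hij.symm]
        · simp
    · simp

/-- Poincaré inequality on polynomials, proved by comparison with the value at an interior point,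
so that no convexity of the domain is needed: the segments only have to stay in a ball. -/
lemma exists_poincare_const (hd : 2 ≤ d) {ϱ : ℝ} (hϱ : 0 < ϱ) (m : ℕ) :
    ∃ C : ℝ, 0 ≤ C ∧ ∀ T : Set (E d), IsOpen T → T.Nonempty → Bornology.IsBounded T →
      IsConnectedByStarShaped ϱ T → ∀ p ∈ Poly d m, ∀ c : ℝ, ∫ x in T, (ev p x - c) = 0 →
      ∫ x in T, (ev p x - c) ^ 2 ≤ C * Metric.diam T ^ 2 * gradSq T p := by
  obtain ⟨C, hC, H⟩ := exists_sup_sq_le_integral_ball (d := d) m (r := ϱ ^ 2 / 2) (by positivity)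
  set ω := volume.real (Metric.closedBall (0 : E d) 1)
  refine ⟨C * ω, by positivity, fun T hT hne hb hreg p hp c hmean => ?_⟩
  obtain ⟨hpos, ⟨a, ha⟩, -⟩ := hreg.exists_uniform_balls hd hϱ hT hne hb
  set h := Metric.diam T
  have haT : a ∈ T := ha (Metric.mem_ball_self (by positivity))
  have hTa : T ⊆ Metric.closedBall a h := fun x hx => Metric.dist_le_diam_of_mem hb hx haT
  have hpt : ∀ x ∈ T, (ev p x - ev p a) ^ 2 ≤ C * (h ^ d)⁻¹ * h ^ 2 * gradSq T p := by
    intro x hx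
    have hxa : ‖x - a‖ ≤ h := mem_closedBall_iff_norm.1 (hTa hx)
    obtain ⟨ξ, hξ, hslope⟩ := exists_hasDerivAt_eq_slope (fun s : ℝ => ev p (a + s • (x - a))) _
      zero_lt_one (by fun_prop) (fun t _ => hasDerivAt_ev_line p a (x - a) t)
    simp only [one_smul, zero_smul, add_zero, sub_zero, div_one, add_sub_cancel] at hslope
    rw [← hslope]
    set z := a + ξ • (x - a)
    have hz : z ∈ Metric.closedBall a h := by
      rw [mem_closedBall_iff_norm, add_sub_cancel_left, norm_smul, Real.norm_of_nonneg hξ.1.le]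
      calc ξ * ‖x - a‖ ≤ 1 * h := by gcongr; exact hξ.2.le
        _ = h := one_mul h
    have hg : ∑ i, ev (MvPolynomial.pderiv i p) z ^ 2 ≤ C * (h ^ d)⁻¹ * gradSq T p := by
      rw [gradSq, Finset.mul_sum]
      refine Finset.sum_le_sum fun i _ => ?_
      refine (H a h hpos _ (pderiv_mem_Poly hp i) z hz).trans ?_
      have : ∫ y in Metric.ball a (ϱ ^ 2 / 2 * h), ev (MvPolynomial.pderiv i p) y ^ 2 ≤
          ∫ y in T, ev (MvPolynomial.pderiv i p) y ^ 2 :=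
        setIntegral_mono_set (integrableOn_ev_sq hT.measurableSet hb hb.measure_lt_top.ne _)
          (Eventually.of_forall fun _ => sq_nonneg _) ha.eventuallyLE
      gcongr
    have hn : ∑ i, (x - a) i ^ 2 ≤ h ^ 2 := by
      rw [← EuclideanSpace.real_norm_sq_eq]
      gcongr
    calc _ ≤ (∑ i, ev (MvPolynomial.pderiv i p) z ^ 2) * ∑ i, (x - a) i ^ 2 :=
          Finset.sum_mul_sq_le_sq_mul_sq _ _ _
      _ ≤ (C * (h ^ d)⁻¹ * gradSq T p) * h ^ 2 := by
          have := gradSq_nonneg T p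
          gcongr
      _ = _ := by ring
  have hvol : volume.real T ≤ h ^ d * ω := by
    have h1 : volume.real T ≤ volume.real (Metric.closedBall a h) :=
      measureReal_mono hTa Metric.isBounded_closedBall.measure_lt_top.ne
    refine h1.trans (le_of_eq ?_)
    rw [Measure.real, Measure.addHaar_closedBall' volume a hpos.le, ENNReal.toReal_mul,
      ENNReal.toReal_ofReal (by positivity), finrank_euclideanSpace_fin]
    rfl
  have hint : ∀ b : ℝ, IntegrableOn (fun x => (ev p x - b) ^ 2) T := fun b =>
    (integrableOn_ev_sq hT.measurableSet hb hb.measure_lt_top.ne (p - MvPolynomial.C b)).congr_fun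
      (fun x _ => by simp) hT.measurableSet
  -- the mean value is the best constant
  have hbest : ∫ x in T, (ev p x - c) ^ 2 ≤ ∫ x in T, (ev p x - ev p a) ^ 2 := by
    have h1 : ∫ x in T, ((ev p x - ev p a) ^ 2 - (ev p x - c) ^ 2) =
        ∫ x in T, ((c - ev p a) ^ 2 + 2 * (c - ev p a) * (ev p x - c)) := by
      congr 1; ext x; ring
    have hi : IntegrableOn (fun x => ev p x - c) T :=
      (integrable_ev_restrict hT hb (p - MvPolynomial.C c)).congr (ae_of_all _ fun x => by simp)
    have hconst : IntegrableOn (fun _ => (c - ev p a) ^ 2) T :=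
      integrableOn_const hb.measure_lt_top.ne
    rw [integral_sub (hint _) (hint _), integral_add hconst
      (hi.const_mul _), integral_const_mul, hmean, mul_zero, add_zero] at h1
    have h2 : 0 ≤ ∫ x in T, (c - ev p a) ^ 2 := integral_nonneg fun _ => sq_nonneg _
    linarith
  have hG := gradSq_nonneg T p
  calc ∫ x in T, (ev p x - c) ^ 2 ≤ ∫ x in T, (ev p x - ev p a) ^ 2 := hbest
    _ ≤ C * (h ^ d)⁻¹ * h ^ 2 * gradSq T p * volume.real T := by
        refine (Real.le_norm_self _).trans
          (norm_setIntegral_le_of_norm_le_const hb.measure_lt_top fun x hx => ?_)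
        rw [Real.norm_of_nonneg (sq_nonneg _)]
        exact hpt x hx
    _ ≤ C * (h ^ d)⁻¹ * h ^ 2 * gradSq T p * (h ^ d * ω) := by gcongr
    _ = _ := by field_simp

/-! ### Coercivity -/

/-- An `L²`-orthogonal projection is a contraction. -/
lemma integral_sq_le_of_orthogonal {μ : Measure (E d)}
    (hμ : ∀ p : MvPolynomial (Fin d) ℝ, Integrable (ev p) μ) {m : ℕ}
    {e g : MvPolynomial (Fin d) ℝ} (he : e ∈ Poly d m)
    (h : ∀ w ∈ Poly d m, ∫ x, ev e x * ev w x ∂μ = ∫ x, ev g x * ev w x ∂μ) :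
    ∫ x, ev e x ^ 2 ∂μ ≤ ∫ x, ev g x ^ 2 ∂μ := by
  have hsq : ∀ p : MvPolynomial (Fin d) ℝ, Integrable (fun x => ev p x ^ 2) μ := fun p =>
    (hμ (p ^ 2)).congr (ae_of_all _ fun x => ev_pow p 2 x)
  have hmul : ∀ p q : MvPolynomial (Fin d) ℝ, Integrable (fun x => ev p x * ev q x) μ :=
    fun p q => (hμ (p * q)).congr (ae_of_all _ fun x => ev_mul p q x)
  have h0 : 0 ≤ ∫ x, ev (g - e) x ^ 2 ∂μ := integral_nonneg fun _ => sq_nonneg _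
  have h1 : ∫ x, ev (g - e) x ^ 2 ∂μ =
      ∫ x, (ev g x ^ 2 + ev e x ^ 2 - 2 * (ev g x * ev e x)) ∂μ := by
    congr 1; ext x; rw [ev_sub]; ring
  have hadd : Integrable (fun x => ev g x ^ 2 + ev e x ^ 2) μ := (hsq g).add (hsq e)
  rw [h1, integral_sub hadd ((hmul g e).const_mul 2), integral_const_mul,
    integral_add (hsq g) (hsq e), ← h e he] at h0
  have h2 : ∫ x, ev e x * ev e x ∂μ = ∫ x, ev e x ^ 2 ∂μ := by
    congr 1; ext x; ring
  rw [h2] at h0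
  linarith

/-- If `δ` is the projection of `p - v` with `v` of degree at most `m`, then `v + δ - c` is the
projection of `p - c`, whence this bound. -/
lemma integral_sq_add_l2Proj_le {μ : Measure (E d)}
    (hμ : ∀ p : MvPolynomial (Fin d) ℝ, Integrable (ev p) μ) {m : ℕ}
    {p q : MvPolynomial (Fin d) ℝ} (hq : q ∈ Poly d m) {f : E d → ℝ} (hf : f =ᵐ[μ] ev (p - q))
    (c : ℝ) :
    ∫ x, ev (q + l2Proj μ m f - MvPolynomial.C c) x ^ 2 ∂μ ≤
      ∫ x, ev (p - MvPolynomial.C c) x ^ 2 ∂μ := by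
  have hmul : ∀ p q : MvPolynomial (Fin d) ℝ, Integrable (fun x => ev p x * ev q x) μ :=
    fun p q => (hμ (p * q)).congr (ae_of_all _ fun x => ev_mul p q x)
  have hfw : ∀ w : MvPolynomial (Fin d) ℝ,
      (fun x => f x * ev w x) =ᵐ[μ] fun x => ev (p - q) x * ev w x := fun w =>
    hf.mono fun x hx => by simp only [hx]
  obtain ⟨hmem, horth⟩ := l2Proj_spec hμ m (g := f) fun w => (hmul _ w).congr (hfw w).symm
  refine integral_sq_le_of_orthogonal hμ (sub_mem (add_mem hq hmem) (C_mem_Poly c m)) fun w hw => ?_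
  have h1 := horth w hw
  rw [integral_congr_ae (hfw w)] at h1
  have h2 : ∫ x, ev (q + l2Proj μ m f - MvPolynomial.C c) x * ev w x ∂μ =
      ∫ x, (ev (q - MvPolynomial.C c) x * ev w x + ev (l2Proj μ m f) x * ev w x) ∂μ := by
    congr 1; ext x; simp only [ev_sub, ev_add]; ring
  rw [h2, integral_add (hmul _ _) (hmul _ _), h1, ← integral_add (hmul _ _) (hmul _ _)]
  congr 1; ext x; simp only [ev_sub]; ring

section Local

variable {T : Set (E d)} {𝓕 : Finset (Set (E d))} {K : Matrix (Fin d) (Fin d) ℝ} {k l : ℕ}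

lemma gradForm_self (v : LocalSpace 𝓕 k l) (hT : IsOpen T) (hb : Bornology.IsBounded T) :
    gradForm T 𝓕 K v v = gradSq T (deltaElem T 𝓕 K v) + (Metric.diam T)⁻¹ *
      ∑ F ∈ 𝓕, ∫ x in F, ev (deltaFace T 𝓕 K v F) x ^ 2 ∂(surf d) := by
  have hi : ∀ i, Integrable (fun x => ev (MvPolynomial.pderiv i (deltaElem T 𝓕 K v)) x ^ 2)
      (volume.restrict T) :=
    fun i => integrableOn_ev_sq hT.measurableSet hb hb.measure_lt_top.ne _
  simp only [gradForm, gradSq, ← integral_finsetSum _ (fun i _ => hi i), dotProduct, grad, ← sq]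

lemma gradForm_self_nonneg (v : LocalSpace 𝓕 k l) (hT : IsOpen T) (hb : Bornology.IsBounded T) :
    0 ≤ gradForm T 𝓕 K v v := by
  rw [gradForm_self v hT hb]
  exact add_nonneg (gradSq_nonneg _ _) (mul_nonneg (inv_nonneg.2 Metric.diam_nonneg)
    (Finset.sum_nonneg fun _ _ => integral_nonneg fun _ => sq_nonneg _))

lemma stabBdry_self (v : LocalSpace 𝓕 k l) :
    stabBdry T 𝓕 K v v = (Metric.diam T)⁻¹ * ∑ F ∈ 𝓕, normalCoeff T K F *
      ∫ x in F, ev (deltaFace T 𝓕 K v F - deltaElem T 𝓕 K v) x ^ 2 ∂(surf d) := by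
  simp only [stabBdry, integral_const_mul, ← ev_sub, ← sq]

lemma stabBdry_self_nonneg (v : LocalSpace 𝓕 k l) (hκ : ∀ F ∈ 𝓕, 0 ≤ normalCoeff T K F) :
    0 ≤ stabBdry T 𝓕 K v v := by
  rw [stabBdry_self]
  exact mul_nonneg (inv_nonneg.2 Metric.diam_nonneg) (Finset.sum_nonneg fun F hF =>
    mul_nonneg (hκ F hF) (integral_nonneg fun _ => sq_nonneg _))

lemma bdrySeminorm_sq (v : LocalSpace 𝓕 k l) (hκ : ∀ F ∈ 𝓕, 0 ≤ normalCoeff T K F) :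
    bdrySeminorm T 𝓕 K v ^ 2 = (Metric.diam T)⁻¹ * ∑ F ∈ 𝓕, normalCoeff T K F *
      ∫ x in F, (v.2.1 x - ev v.1.1 x) ^ 2 ∂(surf d) := by
  have h0 : 0 ≤ ∑ F ∈ 𝓕, normalCoeff T K F *
      ∫ x in F, (v.2.1 x - ev v.1.1 x) ^ 2 ∂(surf d) := Finset.sum_nonneg fun F hF =>
    mul_nonneg (hκ F hF) (integral_nonneg fun _ => sq_nonneg _)
  simp only [bdrySeminorm, integral_const_mul]
  rw [mul_pow, Real.sq_sqrt h0, ← Real.rpow_natCast, ← Real.rpow_mul Metric.diam_nonneg]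
  norm_num [Real.rpow_neg_one]

variable (hT : IsOpen T) (hb : Bornology.IsBounded T) (hpos : 0 < Metric.diam T)
  (h𝓕 : ∀ F ∈ 𝓕, MeasurableSet F ∧ Bornology.IsBounded F ∧ surf d F ≠ ⊤)
  {Khi Ct Cp : ℝ} (hCt : 0 ≤ Ct)
  (hκ : ∀ F ∈ 𝓕, 0 ≤ normalCoeff T K F ∧ normalCoeff T K F ≤ Khi)
  (htrace : ∀ p ∈ Poly d (k + l + 1), ∑ F ∈ 𝓕, ∫ x in F, ev p x ^ 2 ∂(surf d) ≤
    Ct * (Metric.diam T)⁻¹ * ∫ x in T, ev p x ^ 2)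
  (hpoincare : ∀ p ∈ Poly d (k + l + 1), ∀ c : ℝ, ∫ x in T, (ev p x - c) = 0 →
    ∫ x in T, (ev p x - c) ^ 2 ≤ Cp * Metric.diam T ^ 2 * gradSq T p)

include hT hb hpos h𝓕 hCt hκ htrace hpoincare

/-- The boundary stabilisation is controlled by the gradient-based one, since the element
difference operator has zero mean value. -/
lemma stabBdry_self_le {v : LocalSpace 𝓕 k l} (hp : IsPotential T 𝓕 K v (potential T 𝓕 K v))
    (hCp : 0 ≤ Cp) (hKhi : 0 ≤ Khi) :
    stabBdry T 𝓕 K v v ≤ 2 * Khi * (1 + Ct * Cp) * gradForm T 𝓕 K v v := by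
  set p := potential T 𝓕 K v
  set δ := deltaElem T 𝓕 K v
  set h := Metric.diam T
  obtain ⟨hpm, -, hmean⟩ := hp
  obtain ⟨hδm, hδorth⟩ := l2Proj_spec (integrable_ev_restrict hT hb) l
    (g := fun x => ev p x - ev v.1.1 x) fun w => by
      simpa only [← ev_sub] using integrable_ev_mul_restrict hT hb (p - v.1.1) w
  have hδm' : δ ∈ Poly d (k + l + 1) := Poly_mono (by omega) hδm
  have hδ0 : ∫ x in T, (ev δ x - 0) = 0 := by
    have := hδorth _ (C_mem_Poly 1 l)
    simp only [ev_C, mul_one] at this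
    have h2 : ∫ x in T, (ev p x - ev v.1.1 x) = -∫ x in T, (ev v.1.1 x - ev p x) := by
      rw [← integral_neg]; simp
    simp only [sub_zero]
    exact this.trans (by rw [h2, hmean, neg_zero])
  have hP := hpoincare δ hδm' 0 hδ0
  simp only [sub_zero] at hP
  have hTr := htrace δ hδm'
  have hG := gradSq_nonneg T δ
  have hsum : ∑ F ∈ 𝓕, ∫ x in F, ev δ x ^ 2 ∂(surf d) ≤ Ct * Cp * h * gradSq T δ := by
    refine hTr.trans ?_
    calc Ct * h⁻¹ * ∫ x in T, ev δ x ^ 2 ≤ Ct * h⁻¹ * (Cp * h ^ 2 * gradSq T δ) := by gcongr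
      _ = _ := by field_simp
  have hface : ∀ F ∈ 𝓕, normalCoeff T K F *
      ∫ x in F, ev (deltaFace T 𝓕 K v F - δ) x ^ 2 ∂(surf d) ≤
      Khi * (2 * (∫ x in F, ev (deltaFace T 𝓕 K v F) x ^ 2 ∂(surf d) +
        ∫ x in F, ev δ x ^ 2 ∂(surf d))) := by
    intro F hF
    obtain ⟨hm, hbF, hfin⟩ := h𝓕 F hF
    have hi := fun q => integrableOn_ev_sq (μ := surf d) hm hbF hfin q
    have : ∫ x in F, ev (deltaFace T 𝓕 K v F - δ) x ^ 2 ∂(surf d) ≤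
        2 * (∫ x in F, ev (deltaFace T 𝓕 K v F) x ^ 2 ∂(surf d) +
        ∫ x in F, ev δ x ^ 2 ∂(surf d)) := by
      rw [← integral_add (hi _) (hi _), ← integral_const_mul]
      refine integral_mono (hi _) (((hi _).add (hi _)).const_mul 2) fun x => ?_
      simp only [ev_sub]
      nlinarith [sq_nonneg (ev (deltaFace T 𝓕 K v F) x + ev δ x)]
    exact mul_le_mul (hκ F hF).2 this (integral_nonneg fun _ => sq_nonneg _) hKhi
  rw [stabBdry_self, gradForm_self v hT hb]
  set S := ∑ F ∈ 𝓕, ∫ x in F, ev (deltaFace T 𝓕 K v F) x ^ 2 ∂(surf d)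
  have hS : 0 ≤ S := Finset.sum_nonneg fun _ _ => integral_nonneg fun _ => sq_nonneg _
  calc _ ≤ h⁻¹ * ∑ F ∈ 𝓕, Khi * (2 * (∫ x in F, ev (deltaFace T 𝓕 K v F) x ^ 2 ∂(surf d) +
        ∫ x in F, ev δ x ^ 2 ∂(surf d))) := by
        have hh : 0 ≤ h⁻¹ := by positivity
        exact mul_le_mul_of_nonneg_left (Finset.sum_le_sum hface) hh
    _ = h⁻¹ * (Khi * (2 * (S + ∑ F ∈ 𝓕, ∫ x in F, ev δ x ^ 2 ∂(surf d)))) := by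
        rw [← Finset.mul_sum, ← Finset.mul_sum, Finset.sum_add_distrib]
    _ ≤ h⁻¹ * (Khi * (2 * (S + Ct * Cp * h * gradSq T δ))) := by gcongr
    _ = 2 * Khi * (h⁻¹ * S + Ct * Cp * gradSq T δ) := by field_simp
    _ ≤ 2 * Khi * ((1 + Ct * Cp) * (gradSq T δ + h⁻¹ * S)) := by
        gcongr
        have h1 : 0 ≤ h⁻¹ * S := by positivity
        have h2 : 0 ≤ Ct * Cp * (h⁻¹ * S) := by positivity
        linarith
    _ = _ := by ring

/-- The boundary seminorm is controlled by the gradient of the potential and by the boundary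
stabilisation. With `c` the mean value of the potential, `v_F + δ_F - c` and `v_T + δ_T - c` are
projections of the same polynomial, and `v_F - v_T` is their difference minus `δ_F - δ_T`. -/
lemma bdrySeminorm_sq_le {v : LocalSpace 𝓕 k l} (hne : T.Nonempty)
    (hp : potential T 𝓕 K v ∈ Poly d (k + 1)) (hKhi : 0 ≤ Khi) :
    bdrySeminorm T 𝓕 K v ^ 2 ≤ 6 * (Ct * Cp) * (Khi * gradSq T (potential T 𝓕 K v)) +
      3 * stabBdry T 𝓕 K v v := by
  set p := potential T 𝓕 K v
  set δ := deltaElem T 𝓕 K v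
  set h := Metric.diam T
  have hvol : 0 < volume.real T :=
    ENNReal.toReal_pos (hT.measure_pos _ hne).ne' hb.measure_lt_top.ne
  set c : ℝ := (∫ x in T, ev p x) / volume.real T
  have hc : ∫ x in T, (ev p x - c) = 0 := by
    rw [integral_sub (integrable_ev_restrict hT hb p)
      ((integrable_ev_restrict hT hb (MvPolynomial.C c)).congr (ae_of_all _ fun x => ev_C c x))]
    simp only [integral_const, measureReal_restrict_apply_univ, smul_eq_mul, c]
    field_simp
    ring
  have hp' : p ∈ Poly d (k + l + 1) := Poly_mono (by omega) hp
  have hP := hpoincare p hp' c hc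
  set g := p - MvPolynomial.C c with hg
  have hgm : g ∈ Poly d (k + l + 1) := sub_mem hp' (C_mem_Poly _ _)
  have hgP : ∫ x in T, ev g x ^ 2 ≤ Cp * h ^ 2 * gradSq T p := by
    simpa only [hg, ev_sub, ev_C] using hP
  set e := v.1.1 + δ - MvPolynomial.C c with he
  have hδm : δ ∈ Poly d l := (l2Proj_spec (integrable_ev_restrict hT hb) l
    (g := fun x => ev p x - ev v.1.1 x) fun w => by
      simpa only [← ev_sub] using integrable_ev_mul_restrict hT hb (p - v.1.1) w).1
  have hem : e ∈ Poly d (k + l + 1) :=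
    Poly_mono (by omega) (sub_mem (add_mem v.1.2 hδm) (C_mem_Poly c l))
  have heP : ∫ x in T, ev e x ^ 2 ≤ Cp * h ^ 2 * gradSq T p :=
    (integral_sq_add_l2Proj_le (integrable_ev_restrict hT hb) v.1.2
      (ae_of_all _ fun x => (ev_sub p v.1.1 x).symm) c).trans hgP
  have hsum : ∀ q ∈ Poly d (k + l + 1), ∫ x in T, ev q x ^ 2 ≤ Cp * h ^ 2 * gradSq T p →
      ∑ F ∈ 𝓕, ∫ x in F, ev q x ^ 2 ∂(surf d) ≤ Ct * Cp * h * gradSq T p := by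
    intro q hq hqP
    refine (htrace q hq).trans ?_
    calc Ct * h⁻¹ * ∫ x in T, ev q x ^ 2 ≤ Ct * h⁻¹ * (Cp * h ^ 2 * gradSq T p) := by gcongr
      _ = _ := by field_simp
  have hface : ∀ F ∈ 𝓕, normalCoeff T K F * ∫ x in F, (v.2.1 x - ev v.1.1 x) ^ 2 ∂(surf d) ≤
      3 * Khi * (∫ x in F, ev g x ^ 2 ∂(surf d) + ∫ x in F, ev e x ^ 2 ∂(surf d)) +
      3 * (normalCoeff T K F *
        ∫ x in F, ev (deltaFace T 𝓕 K v F - δ) x ^ 2 ∂(surf d)) := by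
    intro F hF
    obtain ⟨hm, hbF, hfin⟩ := h𝓕 F hF
    obtain ⟨q, hqm, hq⟩ := v.2.2 F hF
    have hμ := fun q => integrableOn_ev (μ := surf d) hm hbF hfin q
    have hi := fun q => integrableOn_ev_sq (μ := surf d) hm hbF hfin q
    set η := deltaFace T 𝓕 K v F
    set eF := q + η - MvPolynomial.C c with heF
    have heFP : ∫ x in F, ev eF x ^ 2 ∂(surf d) ≤ ∫ x in F, ev g x ^ 2 ∂(surf d) :=
      integral_sq_add_l2Proj_le hμ hqm
        ((ae_restrict_iff' hm).2 (ae_of_all _ fun x hx => by rw [ev_sub, hq hx])) c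
    have hv : ∫ x in F, (v.2.1 x - ev v.1.1 x) ^ 2 ∂(surf d) ≤
        3 * (∫ x in F, ev eF x ^ 2 ∂(surf d) + ∫ x in F, ev e x ^ 2 ∂(surf d)) +
        3 * ∫ x in F, ev (η - δ) x ^ 2 ∂(surf d) := by
      have hadd : IntegrableOn (fun x => 3 * (ev eF x ^ 2 + ev e x ^ 2)) F (surf d) :=
        ((hi eF).add (hi e)).const_mul 3
      rw [setIntegral_congr_fun (g := fun x => ev (q - v.1.1) x ^ 2) hm
        (fun x hx => by simp only [ev_sub, hq hx]),
        ← integral_add (hi _) (hi _), ← integral_const_mul, ← integral_const_mul,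
        ← integral_add hadd ((hi _).const_mul 3)]
      refine integral_mono (hi _) (hadd.add ((hi _).const_mul 3)) fun x => ?_
      have hx : ev (q - v.1.1) x = ev eF x - ev e x - ev (η - δ) x := by
        simp only [heF, he, ev_sub, ev_add]; ring
      simp only [hx]
      nlinarith [sq_nonneg (ev eF x + ev e x), sq_nonneg (ev eF x + ev (η - δ) x),
        sq_nonneg (ev e x - ev (η - δ) x)]
    have hnn : 0 ≤ ∫ x in F, ev eF x ^ 2 ∂(surf d) + ∫ x in F, ev e x ^ 2 ∂(surf d) :=
      add_nonneg (integral_nonneg fun _ => sq_nonneg _) (integral_nonneg fun _ => sq_nonneg _)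
    obtain ⟨hκ0, hκ1⟩ := hκ F hF
    calc _ ≤ normalCoeff T K F * (3 * (∫ x in F, ev eF x ^ 2 ∂(surf d) +
          ∫ x in F, ev e x ^ 2 ∂(surf d)) + 3 * ∫ x in F, ev (η - δ) x ^ 2 ∂(surf d)) := by gcongr
      _ = 3 * normalCoeff T K F * (∫ x in F, ev eF x ^ 2 ∂(surf d) +
          ∫ x in F, ev e x ^ 2 ∂(surf d)) +
          3 * (normalCoeff T K F * ∫ x in F, ev (η - δ) x ^ 2 ∂(surf d)) := by ring
      _ ≤ _ := by gcongr
  rw [bdrySeminorm_sq v fun F hF => (hκ F hF).1, stabBdry_self]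
  set S := ∑ F ∈ 𝓕, normalCoeff T K F *
    ∫ x in F, ev (deltaFace T 𝓕 K v F - δ) x ^ 2 ∂(surf d)
  have h1 := hsum g hgm hgP
  have h2 := hsum e hem heP
  calc _ ≤ h⁻¹ * ∑ F ∈ 𝓕, (3 * Khi * (∫ x in F, ev g x ^ 2 ∂(surf d) +
        ∫ x in F, ev e x ^ 2 ∂(surf d)) + 3 * (normalCoeff T K F *
        ∫ x in F, ev (deltaFace T 𝓕 K v F - δ) x ^ 2 ∂(surf d))) := by
        have hh : 0 ≤ h⁻¹ := by positivity
        exact mul_le_mul_of_nonneg_left (Finset.sum_le_sum hface) hh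
    _ = h⁻¹ * (3 * Khi * (∑ F ∈ 𝓕, ∫ x in F, ev g x ^ 2 ∂(surf d) +
        ∑ F ∈ 𝓕, ∫ x in F, ev e x ^ 2 ∂(surf d)) + 3 * S) := by
        simp only [S, Finset.mul_sum, Finset.sum_add_distrib, mul_add]
    _ ≤ h⁻¹ * (3 * Khi * (Ct * Cp * h * gradSq T p + Ct * Cp * h * gradSq T p) + 3 * S) := by
        gcongr
    _ = _ := by
        change _ = 6 * (Ct * Cp) * (Khi * gradSq T p) + 3 * (h⁻¹ * S)
        field_simp
        ring

end Local

lemma normalCoeff_mem_Icc {T F : Set (E d)} {K : Matrix (Fin d) (Fin d) ℝ} {Klo Khi : ℝ}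
    (hK : ∀ x : Fin d → ℝ, Klo * (x ⬝ᵥ x) ≤ (K *ᵥ x) ⬝ᵥ x ∧ (K *ᵥ x) ⬝ᵥ x ≤ Khi * (x ⬝ᵥ x))
    (hn : ∃ n, IsOutwardUnitNormal T F n) : normalCoeff T K F ∈ Icc Klo Khi := by
  have h1 : ‖outwardNormal T F‖ = 1 := (Classical.epsilon_spec hn).1
  have h2 : (outwardNormal T F).ofLp ⬝ᵥ (outwardNormal T F).ofLp = 1 := by
    have := EuclideanSpace.real_norm_sq_eq (outwardNormal T F)
    rw [h1] at this
    simp only [dotProduct, ← sq]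
    linarith
  have := hK (outwardNormal T F).ofLp
  rw [h2, mul_one, mul_one] at this
  exact this

lemma IsFlatFace.measurableSet {F : Set (E d)} (hF : IsFlatFace F) : MeasurableSet F := by
  obtain ⟨-, ⟨ν, c, U, -, hU, rfl⟩, -⟩ := hF
  exact hU.measurableSet.inter (isClosed_eq (by fun_prop) continuous_const).measurableSet

lemma IsPolytope.isOpen {T : Set (E d)} (hT : IsPolytope T) : IsOpen T := by
  obtain ⟨-, S, -, rfl⟩ := hT
  exact isOpen_interior

lemma IsPolytope.isBounded {T : Set (E d)} (hT : IsPolytope T) : Bornology.IsBounded T := by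
  obtain ⟨-, S, -, rfl⟩ := hT
  refine Bornology.IsBounded.subset ?_ interior_subset
  exact (Bornology.isBounded_biUnion_finset S).2 fun s _ =>
    isBounded_convexHull.2 (Set.finite_range s).isBounded

end HHO

end

theorem mainTheorem7 (d : ℕ) (hd : 2 ≤ d) (Ω : Set (HHO.E d)) (hΩ : HHO.IsPolytope Ω)
    (ϱ : ℝ) (hϱ : 0 < ϱ) (k l : ℕ) (hkl : |(k : ℤ) - (l : ℤ)| ≤ 1) :
    ∃ C : ℝ, 0 < C ∧
      ∀ M : HHO.PolytopalMesh Ω, M.IsRegular ϱ →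
      ∀ T ∈ M.elements,
      ∀ (K : Matrix (Fin d) (Fin d) ℝ) (Klo Khi : ℝ), K.IsSymm → 0 < Klo → Klo ≤ Khi →
        (∀ x : Fin d → ℝ, Klo * (x ⬝ᵥ x) ≤ (K *ᵥ x) ⬝ᵥ x ∧ (K *ᵥ x) ⬝ᵥ x ≤ Khi * (x ⬝ᵥ x)) →
        HHO.IsCoerciveStab (k := k) (l := l) T (M.facesOf T) K Klo Khi C
          (HHO.stabGradMin T (M.facesOf T) K Klo) ∧
        HHO.IsCoerciveStab (k := k) (l := l) T (M.facesOf T) K Klo Khi C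
          (HHO.stabBdry T (M.facesOf T) K) ∧
        HHO.IsCoerciveStab (k := k) (l := l) T (M.facesOf T) K Klo Khi C
          (HHO.stabGradMax T (M.facesOf T) K Khi) := by
  obtain ⟨A, -, hA⟩ := HHO.exists_surf_frontier_le hd hϱ
  obtain ⟨Ct, hCt, htr⟩ := HHO.exists_trace_const hd hϱ (k + l + 1)
  obtain ⟨Cp, hCp, hpo⟩ := HHO.exists_poincare_const hd hϱ (k + l + 1)
  refine ⟨6 * (Ct * Cp) + 6 * (1 + Ct * Cp), by positivity,
    fun M hreg T hTM K Klo Khi hsymm hlo hlh hK => ?_⟩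
  have hpoly := M.polytope T hTM
  have hT := hpoly.isOpen
  have hb := hpoly.isBounded
  have hne := hpoly.1.nonempty
  have hstar := hreg.1 T hTM
  have hpos := (hstar.exists_uniform_balls hd hϱ hT hne hb).1
  have hfaces : ∀ F ∈ M.facesOf T, F ∈ M.faces ∧ F ⊆ frontier T := fun F hF => by
    classical exact Finset.mem_filter.1 hF
  have hmeas : ∀ F ∈ M.facesOf T, MeasurableSet F ∧ F ⊆ frontier T := fun F hF =>
    ⟨(M.flat F (hfaces F hF).1).measurableSet, (hfaces F hF).2⟩
  have h𝓕 : ∀ F ∈ M.facesOf T, MeasurableSet F ∧ Bornology.IsBounded F ∧ HHO.surf d F ≠ ⊤ :=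
    fun F hF => ⟨(hmeas F hF).1, hb.closure.subset ((hmeas F hF).2.trans frontier_subset_closure),
      ((measure_mono (hmeas F hF).2).trans_lt
        ((hA T hT hne hb hstar).trans_lt ENNReal.ofReal_lt_top)).ne⟩
  have hdisj : (M.facesOf T : Set (Set (HHO.E d))).PairwiseDisjoint id :=
    M.faces_disjoint.subset fun F hF => (hfaces F hF).1
  have hκ : ∀ F ∈ M.facesOf T, 0 ≤ HHO.normalCoeff T K F ∧ HHO.normalCoeff T K F ≤ Khi := by
    intro F hF
    have := HHO.normalCoeff_mem_Icc hK (M.one_sided T hTM F (hfaces F hF).1 (hfaces F hF).2)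
    exact ⟨hlo.le.trans this.1, this.2⟩
  have hhi : 0 < Khi := hlo.trans_le hlh
  have htr' := htr T hT hne hb hstar (M.facesOf T) hmeas hdisj
  have hpo' := hpo T hT hne hb hstar
  set α := Khi / Klo with hα
  have hα1 : 1 ≤ α := (one_le_div hlo).2 hlh
  have hKα : Khi = α * Klo := by rw [hα, div_mul_cancel₀ _ hlo.ne']
  have key : ∀ v : HHO.LocalSpace (M.facesOf T) k l,
      0 ≤ HHO.stabBdry T (M.facesOf T) K v v ∧ 0 ≤ HHO.gradForm T (M.facesOf T) K v v ∧
      HHO.stabBdry T (M.facesOf T) K v v ≤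
        2 * Khi * (1 + Ct * Cp) * HHO.gradForm T (M.facesOf T) K v v ∧
      ∃ e, 0 ≤ e ∧ e = (∫ x in T, (K *ᵥ HHO.grad (HHO.potential T (M.facesOf T) K v) x) ⬝ᵥ
        HHO.grad (HHO.potential T (M.facesOf T) K v) x) ∧
      HHO.bdrySeminorm T (M.facesOf T) K v ^ 2 ≤
        6 * (Ct * Cp) * (α * e) + 3 * HHO.stabBdry T (M.facesOf T) K v v := by
    intro v
    have hp : HHO.IsPotential T (M.facesOf T) K v (HHO.potential T (M.facesOf T) K v) :=
      Classical.epsilon_spec (HHO.exists_isPotential hT hne hb h𝓕 hsymm hlo (fun x => (hK x).1) v)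
    have hen := HHO.mul_gradSq_le_energy hT hb (fun x => (hK x).1)
      (HHO.potential T (M.facesOf T) K v)
    have hG := HHO.gradSq_nonneg T (HHO.potential T (M.facesOf T) K v)
    refine ⟨HHO.stabBdry_self_nonneg v fun F hF => (hκ F hF).1,
      HHO.gradForm_self_nonneg v hT hb,
      HHO.stabBdry_self_le hT hb hpos h𝓕 hCt hκ htr' hpo' hp hCp hhi.le, _,
      le_trans (by positivity) hen, rfl, ?_⟩
    refine (HHO.bdrySeminorm_sq_le hT hb hpos h𝓕 hCt hκ htr' hpo' hne hp.1 hhi.le).trans ?_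
    refine add_le_add (mul_le_mul_of_nonneg_left ?_ (by positivity)) le_rfl
    rw [hKα, mul_assoc]
    exact mul_le_mul_of_nonneg_left hen (zero_le_one.trans hα1)
  set P := Ct * Cp
  have hP : 0 ≤ P := by positivity
  have hα0 : 0 ≤ α := zero_le_one.trans hα1
  -- a stabilisation that controls the boundary one up to the factor `α` is coercive
  have hconcl : ∀ b e s S : ℝ, 0 ≤ e → 0 ≤ S → b ≤ 6 * P * (α * e) + 3 * s →
      s ≤ 2 * (1 + P) * (α * S) → b ≤ (6 * P + 6 * (1 + P)) * α * (e + S) := by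
    intro b e s S he hS hb hs
    have h1 : 0 ≤ 6 * (1 + P) * (α * e) := by positivity
    have h2 : 0 ≤ 6 * P * (α * S) := by positivity
    calc b ≤ 6 * P * (α * e) + 6 * (1 + P) * (α * S) := by linarith
      _ ≤ 6 * P * (α * e) + 6 * (1 + P) * (α * S) + 6 * (1 + P) * (α * e) + 6 * P * (α * S) := by
        linarith
      _ = _ := by ring
  refine ⟨fun v => ?_, fun v => ?_, fun v => ?_⟩
  all_goals
    obtain ⟨hs, hg, hsg, e, he0, he, hv⟩ := key v
    rw [HHO.localForm, ← he]
    refine hconcl _ e _ _ he0 ?_ hv ?_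
  · exact mul_nonneg hlo.le hg
  · refine hsg.trans (le_of_eq ?_)
    rw [HHO.stabGradMin, hKα]
    ring
  · exact hs
  · have h1 : 0 ≤ P * (α * HHO.stabBdry T (M.facesOf T) K v v) := by positivity
    have h2 := mul_le_mul_of_nonneg_right hα1 hs
    linarith
  · exact mul_nonneg hhi.le hg
  · rw [HHO.stabGradMax]
    calc _ ≤ 2 * (1 + P) * (1 * (Khi * HHO.gradForm T (M.facesOf T) K v v)) :=
          hsg.trans (le_of_eq (by ring))
      _ ≤ _ := by gcongr
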